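/- Let $X$ be a compact complex manifold of dimension $n$, $L\to X$ a holomorphic line bundle, and $h$ a smooth Hermitian metric on $L$ whose curvature form $\omega=-\frac{\sqrt{-1}}{2\pi}\partial\bar\partial\log h$ is positive (for instance, $X\subset\mathbb P^N$ a smooth projective variety and $L=\mathcal O(1)|_X$). Let $P(X,\omega)$ be the set of smooth real functions $\varphi$ with $\omega_\varphi=\omega+\frac{\sqrt{-1}}{2\pi}\partial\bar\partial\varphi>0$, let $\varphi\in P(X,\omega)$, and let $\varphi_t$ $(0\le t\le 1)$ be a smooth path in $P(X,\omega)$ from $\varphi_0=0$ to $\varphi_1=\varphi$. Write $\omega_t=\omega_{\varphi_t}$, let $g_t=(g_{i\bar j})$ be the matrix with $\omega_t=\frac{\sqrt{-1}}{2\pi}\sum g_{i\bar j}\,dz_i\wedge d\bar z_j$ in local coordinates, and let $R_{g}=\bar\partial(\partial(g)g^{-1})$ be its curvature. Let $\chi$ be the Hilbert polynomial of $(X,L)$, i.e. $\chi(m)=\dim H^0(X,L^m)$ for all large $m$. Let $0\le l\le n+1$, and let $c_{l,k}$ be the coefficient of $m^{-l}$ in the expansion at $m=\infty$ of $\frac{m^k}{m\chi(m)}$,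 so that the coefficient of $m^{-l}$ in $\frac{1}{m\chi(m)}\sum_{k\le n+1}a_km^k$ is $\sum_{n+1-l\le k\le n+1}c_{l,k}a_k$. Put $P_{k,s}(m)=\sum_{j=0}^{k}(-1)^{j}\binom kj(m+j)^s$, fix an integer $m\ge 0$, let $(q_{n+1}(m),\dots,q_{n+1-l}(m))$ be the unique solution of the upper triangular system $\sum_{j=0}^{l}P_{n+1-j,k}(m)\,q_{n+1-j}(m)=c_{l,k}$ $(n+1-l\le k\le n+1)$, and put $$\mathcal E_l(m)=\sum_{j=0}^{l}\sum_{i=0}^{n+1-j}q_{n+1-j}(m)(-1)^i\binom{n+1-j}{i}L^{m+i}\in\mathbb Q[L].$$ For $\xi=\sum_j a_jL^j$ with $a_j\in\mathbb Q$ write $\mathrm{Ch}(F^{\xi}_{H_t}+b\dot H_tH_t^{-1})=\sum_j a_j\sum_{k\ge 0}\frac1{k!}\bigl(F^{L^j}_{H_t}+b\dot H_tH_t^{-1}\bigr)^k$, where on $L^j$ one takes $H_t=e^{-j\varphi_t}h^j$ with curvature $F^{L^j}_{H_t}=-\partial\bar\partial\log H_t$, and let $\mathrm{Td}=\sum_k\mathrm{Td}_k$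 be the Todd series $\det\bigl(A/(1-e^{-A})\bigr)$, with $\mathrm{Td}_k$ its homogeneous component of degree $k$. The higher energy, computed along the path $\varphi_t$, is $$F_{\omega,l}(\varphi)=\Bigl(\frac{\sqrt{-1}}{2\pi}\Bigr)^{n}\int_X\int_0^1\frac{\partial}{\partial b}\Bigl(\mathrm{Td}\bigl(R_{g_t}+b\,\tfrac{\partial g_t}{\partial t}g_t^{-1}\bigr)\,\mathrm{Ch}\bigl(F^{\mathcal E_l(m)}_{H_t}+b\,\tfrac{\partial H_t}{\partial t}H_t^{-1}\bigr)\Bigr)\Big|_{b=0}\,dt .$$ Then $$\begin{aligned}F_{\omega,l}(\varphi)=&\int_X\int_0^1\sum_{n+1-l\le k\le n}\frac{c_{l,k}}{k!}\,\frac{\partial}{\partial b}\mathrm{Td}_{n+1-k}\Bigl(\frac{\sqrt{-1}}{2\pi}R_{g_t}+b\,\frac{\partial g_t}{\partial t}g_t^{-1}\Bigr)\Big|_{b=0}\,\omega_t^{k}\,dt\\&-\int_X\int_0^1\sum_{n+1-l\le k\le n+1}\frac{k\,c_{l,k}}{k!}\,\mathrm{Td}_{n+1-k}\Bigl(\frac{\sqrt{-1}}{2\pi}R_{g_t}\Bigr)\frac{\partial\varphi_t}{\partial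 t}\,\omega_t^{k-1}\,dt .\end{aligned}$$ -/

import Mathlib

open scoped Manifold ContDiff Topology ComplexOrder

noncomputable section

namespace HigherEnergy

/-! ## Pointwise exterior forms of even degree on `ℂⁿ`

The complexified cotangent space at a point of `ℂⁿ` is `Fin n × Fin 2 → ℂ`; the basis vectors
`(j, 0)` and `(j, 1)` are `dx_j` and `dy_j`. -/

/-- The complexified cotangent space of `ℂⁿ` at a point. -/
abbrev Cotangent (n : ℕ) : Type := Fin n × Fin 2 → ℂ

/-- The algebra `⨁ₚ Λ²ᵖ` of complex exterior forms of even degree at a point of `ℂⁿ`. -/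
abbrev EvenForm (n : ℕ) : Type :=
  ↥(CliffordAlgebra.even (0 : QuadraticForm ℂ (Cotangent n)))

theorem ExteriorAlgebra.even_mul_comm {V : Type*} [AddCommGroup V] [Module ℂ V]
    (x y : ExteriorAlgebra ℂ V)
    (hx : x ∈ CliffordAlgebra.even (0 : QuadraticForm ℂ V)) : x * y = y * x := by
  have hswap : ∀ u v : V, ExteriorAlgebra.ι ℂ u * ExteriorAlgebra.ι ℂ v =
      -(ExteriorAlgebra.ι ℂ v * ExteriorAlgebra.ι ℂ u) := fun u v =>
    eq_neg_of_add_eq_zero_left (ExteriorAlgebra.ι_add_mul_swap u v)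
  have hι : ∀ (u v : V) (z : ExteriorAlgebra ℂ V),
      (ExteriorAlgebra.ι ℂ u * ExteriorAlgebra.ι ℂ v) * z =
        z * (ExteriorAlgebra.ι ℂ u * ExteriorAlgebra.ι ℂ v) := by
    intro u v z
    induction z using ExteriorAlgebra.induction with
    | algebraMap r => exact (Algebra.commutes r _).symm
    | ι w =>
      calc ExteriorAlgebra.ι ℂ u * ExteriorAlgebra.ι ℂ v * ExteriorAlgebra.ι ℂ w
          = ExteriorAlgebra.ι ℂ u * (ExteriorAlgebra.ι ℂ v * ExteriorAlgebra.ι ℂ w) :=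
            mul_assoc _ _ _
        _ = -(ExteriorAlgebra.ι ℂ u * ExteriorAlgebra.ι ℂ w) * ExteriorAlgebra.ι ℂ v := by
            rw [hswap v w, mul_neg, ← mul_assoc, neg_mul]
        _ = ExteriorAlgebra.ι ℂ w * (ExteriorAlgebra.ι ℂ u * ExteriorAlgebra.ι ℂ v) := by
            rw [hswap u w, neg_neg, mul_assoc]
    | mul a b ha hb => rw [← mul_assoc, ha, mul_assoc, hb, mul_assoc]
    | add a b ha hb => rw [mul_add, add_mul, ha, hb]
  have key : ∀ (x : CliffordAlgebra (0 : QuadraticForm ℂ V))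
      (_ : x ∈ CliffordAlgebra.evenOdd (0 : QuadraticForm ℂ V) 0),
      ∀ y : ExteriorAlgebra ℂ V, (x : ExteriorAlgebra ℂ V) * y = y * x := by
    intro x hx
    induction x, hx using CliffordAlgebra.even_induction with
    | algebraMap r => exact fun y => Algebra.commutes r y
    | add a b _ _ ha hb => intro y; rw [add_mul, mul_add, ha, hb]
    | ι_mul_ι_mul u v a _ ha =>
      intro y
      have h1 := hι u v y
      change (ExteriorAlgebra.ι ℂ u * ExteriorAlgebra.ι ℂ v) * a * y =
        y * ((ExteriorAlgebra.ι ℂ u * ExteriorAlgebra.ι ℂ v) * a)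
      rw [mul_assoc, ha, ← mul_assoc, h1, mul_assoc]
  exact key x hx y

/-- Forms of even degree commute under the wedge product. -/
instance EvenForm.instCommRing (n : ℕ) : CommRing (EvenForm n) :=
  { (inferInstance : Ring (EvenForm n)) with
    mul_comm := fun x y => Subtype.ext (ExteriorAlgebra.even_mul_comm x.1 y.1 x.2) }

/-- `dz_j = dx_j + √-1 dy_j`. -/
def dz {n : ℕ} (j : Fin n) : Cotangent n := Pi.single (j, 0) 1 + Pi.single (j, 1) Complex.I

/-- `d\bar z_j = dx_j - √-1 dy_j`. -/
def dzbar {n : ℕ} (j : Fin n) : Cotangent n := Pi.single (j, 0) 1 - Pi.single (j, 1) Complex.I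

/-- The two-form `dz_k ∧ d\bar z_l`. -/
def dzdzbar {n : ℕ} (k l : Fin n) : EvenForm n :=
  (CliffordAlgebra.even.ι (0 : QuadraticForm ℂ (Cotangent n))).bilin (dz k) (dzbar l)

/-- The coefficient of `dx₁ ∧ dy₁ ∧ ⋯ ∧ dxₙ ∧ dyₙ` of the component of degree `2n` of a form. -/
def topCoeff (n : ℕ) : EvenForm n →ₗ[ℂ] ℂ :=
  (ExteriorAlgebra.liftAlternating (R := ℂ) (M := Cotangent n) (N := ℂ)
    (Pi.single (n * 2)
      ((Matrix.detRowAlternating (R := ℂ) (n := Fin n × Fin 2)).domDomCongr finProdFinEquiv))) ∘ₗ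
    (CliffordAlgebra.even (0 : QuadraticForm ℂ (Cotangent n))).val.toLinearMap

/-! ## Invariant polynomials -/

/-- The Todd polynomial `Td_k(M)` of a square matrix: the component of degree `k` in the entries
of `M` of `det (M / (1 - exp (-M)))`, where `x / (1 - exp (-x)) = ∑ B_r x^r / r!`, `B_1 = 1/2`. -/
def todd {A : Type*} [CommRing A] [Algebra ℂ A] {ι : Type*} [Fintype ι] [DecidableEq ι]
    (k : ℕ) (M : Matrix ι ι A) : A :=
  PowerSeries.coeff k (Matrix.det (Matrix.of fun i j : ι =>
    PowerSeries.mk fun r => ((bernoulli' r / (r.factorial : ℚ) : ℚ) : ℂ) • (M ^ r) i j))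

/-- The component `Ch_k` of the Chern character of a virtual bundle `∑ a_j L^j`, represented by
the polynomial `∑ a_j T^j`, when `A j` is the curvature of `L^j`. -/
def chernCharacter {A : Type*} [CommRing A] [Algebra ℂ A] (k : ℕ) (ξ : Polynomial ℚ) (A' : ℕ → A) : A :=
  ∑ j ∈ ξ.support, ((ξ.coeff j : ℚ) : ℂ) • ((1 / (k.factorial : ℂ)) • A' j ^ k)

/-! ## Calculus on open subsets of `ℂⁿ` -/

/-- `∂f/∂z_k`. -/
def wirt {n : ℕ} (k : Fin n) (f : (Fin n → ℂ) → ℂ) (z : Fin n → ℂ) : ℂ :=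
  (1 / 2) * (fderiv ℝ f z (Pi.single k 1) - Complex.I * fderiv ℝ f z (Pi.single k Complex.I))

/-- `∂f/∂\bar z_k`. -/
def wirtBar {n : ℕ} (k : Fin n) (f : (Fin n → ℂ) → ℂ) (z : Fin n → ℂ) : ℂ :=
  (1 / 2) * (fderiv ℝ f z (Pi.single k 1) + Complex.I * fderiv ℝ f z (Pi.single k Complex.I))

/-- The complex Hessian `∂²f/∂z_i∂\bar z_j`. -/
def hess {n : ℕ} (f : (Fin n → ℂ) → ℂ) (z : Fin n → ℂ) : Matrix (Fin n) (Fin n) ℂ :=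
  Matrix.of fun i j => wirt i (wirtBar j f) z

/-- The form `∑ a_{kl} dz_k ∧ d\bar z_l`. -/
def formOfMatrix {n : ℕ} (a : Matrix (Fin n) (Fin n) ℂ) : EvenForm n :=
  ∑ k, ∑ l, a k l • dzdzbar k l

/-- The matrix `∂g/∂z_k · g⁻¹`, the coefficient of `dz_k` in `∂(g) g⁻¹`. -/
def connectionCoeff {n : ℕ} (g : (Fin n → ℂ) → Matrix (Fin n) (Fin n) ℂ) (k : Fin n)
    (z : Fin n → ℂ) : Matrix (Fin n) (Fin n) ℂ :=
  (Matrix.of fun i j => wirt k (fun w => g w i j) z) * (g z)⁻¹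

/-- The curvature `R_g = \bar∂(∂(g) g⁻¹)`, a matrix of two-forms; note that
`\bar∂(θ dz_k) = ∑ ∂θ/∂\bar z_l d\bar z_l ∧ dz_k = -∑ ∂θ/∂\bar z_l dz_k ∧ d\bar z_l`. -/
def curvature {n : ℕ} (g : (Fin n → ℂ) → Matrix (Fin n) (Fin n) ℂ) (z : Fin n → ℂ) :
    Matrix (Fin n) (Fin n) (EvenForm n) :=
  Matrix.of fun i j =>
    -formOfMatrix (Matrix.of fun k l => wirtBar l (fun w => connectionCoeff g k w i j) z)

/-- A matrix of complex numbers regarded as a matrix of forms of degree zero. -/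
def degreeZero {n : ℕ} (a : Matrix (Fin n) (Fin n) ℂ) : Matrix (Fin n) (Fin n) (EvenForm n) :=
  a.map (algebraMap ℂ (EvenForm n))

/-! ## Integration of forms of top degree on a compact complex manifold -/

section Integration

variable (n : ℕ) (X : Type*) [TopologicalSpace X] [CompactSpace X] [T2Space X]
  [ChartedSpace (Fin n → ℂ) X]

theorem exists_chartPartition : ∃ ρ : PartitionOfUnity X X Set.univ,
    ρ.IsSubordinate fun c => (chartAt (Fin n → ℂ) c).source :=
  PartitionOfUnity.exists_isSubordinate isClosed_univ _
    (fun c => (chartAt (Fin n → ℂ) c).open_source)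
    (fun x _ => Set.mem_iUnion.2 ⟨x, mem_chart_source _ x⟩)

/-- A partition of unity subordinate to the cover of `X` by the domains of preferred charts. -/
def chartPartition : PartitionOfUnity X X Set.univ := (exists_chartPartition n X).choose

variable {n X}

/-- The integral over `X` of the form of degree `2n` given in the preferred chart at `c` by
`f c z dx₁ ∧ dy₁ ∧ ⋯ ∧ dxₙ ∧ dyₙ`. -/
def integral (f : X → (Fin n → ℂ) → ℂ) : ℂ :=
  ∑ᶠ c : X, ∫ z in (chartAt (Fin n → ℂ) c).target,
    (chartPartition n X c ((chartAt (Fin n → ℂ) c).symm z) : ℂ) * f c z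

end Integration

/-! ## Hermitian line bundles -/

section LineBundle

variable {n : ℕ} {X : Type*} [TopologicalSpace X] [ChartedSpace (Fin n → ℂ) X]
  (L : X → Type*) [∀ x, AddCommGroup (L x)] [∀ x, Module ℂ (L x)]
  [TopologicalSpace (Bundle.TotalSpace ℂ L)] [∀ x, TopologicalSpace (L x)]
  [FiberBundle ℂ L] [VectorBundle ℂ ℂ L]

/-- The frame of `L` near `x₀` given by the preferred trivialization at `x₀`. -/
def frame (x₀ y : X) : L y := (trivializationAt ℂ L x₀).symm y (1 : ℂ)

variable (n) in
/-- A smooth Hermitian metric on the line bundle `L`. -/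
structure HermitianMetric where
  /-- the Hermitian form on each fibre, conjugate linear in the first variable -/
  form : ∀ x, L x →ₗ⋆[ℂ] L x →ₗ[ℂ] ℂ
  symm : ∀ x v w, starRingEnd ℂ (form x v w) = form x w v
  pos : ∀ x v, v ≠ 0 → 0 < (form x v v).re
  smooth : ∀ x₀, ContMDiffOn 𝓘(ℝ, Fin n → ℂ) 𝓘(ℝ, ℝ) ∞
    (fun y => (form y (frame L x₀ y) (frame L x₀ y)).re) (trivializationAt ℂ L x₀).baseSet

variable {L}

/-- The square of the length of the local frame of `L` near `x₀`. -/
def HermitianMetric.weight (h : HermitianMetric n L) (x₀ y : X) : ℝ :=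
  (h.form y (frame L x₀ y) (frame L x₀ y)).re

/-- The metric `exp (-j φ) h^j` on `L^j`, in the `j`-th power of the local frame near `x₀`. -/
def powerWeight (h : HermitianMetric n L) (φ : X → ℝ) (j : ℕ) (x₀ y : X) : ℝ :=
  Real.exp (-(j * φ y)) * h.weight x₀ y ^ j

/-- The curvature `-∂\bar∂ log H` of the metric `H = exp (-j φ) h^j` on `L^j`, at the point with
coordinate `z` in the preferred chart at `c`. -/
def lineCurvature (h : HermitianMetric n L) (φ : X → ℝ) (j : ℕ) (c : X) (z : Fin n → ℂ) :
    EvenForm n :=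
  -formOfMatrix (hess (fun w => ((Real.log (powerWeight h φ j
    ((chartAt (Fin n → ℂ) c).symm z) ((chartAt (Fin n → ℂ) c).symm w)) : ℝ) : ℂ)) z)

/-- `∂H/∂t · H⁻¹` for the path of metrics `H = exp (-j φ_t) h^j` on `L^j`. -/
def lineVariation (h : HermitianMetric n L) (φ : ℝ → X → ℝ) (j : ℕ) (t : ℝ) (x : X) : ℝ :=
  deriv (fun s => powerWeight h (φ s) j x x) t * (powerWeight h (φ t) j x x)⁻¹

/-- The matrix `g_{i\bar j}` of `ω_φ = ω + (√-1/2π) ∂\bar∂φ = (√-1/2π) ∑ g_{i\bar j} dz_i ∧ d\bar z_j`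
in the preferred chart at `c`, where `ω = -(√-1/2π) ∂\bar∂ log h`. -/
def metricMatrix (h : HermitianMetric n L) (φ : X → ℝ) (c : X) (z : Fin n → ℂ) :
    Matrix (Fin n) (Fin n) ℂ :=
  -hess (fun w => ((Real.log (h.weight ((chartAt (Fin n → ℂ) c).symm z)
      ((chartAt (Fin n → ℂ) c).symm w)) : ℝ) : ℂ)) z
    + hess (fun w => ((φ ((chartAt (Fin n → ℂ) c).symm w) : ℝ) : ℂ)) z

/-- The form `ω_φ = ω + (√-1/2π) ∂\bar∂φ`. -/
def kahlerForm (h : HermitianMetric n L) (φ : X → ℝ) (c : X) (z : Fin n → ℂ) : EvenForm n :=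
  (Complex.I / (2 * Real.pi)) • formOfMatrix (metricMatrix h φ c z)

/-- `φ` lies in `P(X, ω)`: it is smooth and `ω_φ` is positive. -/
def IsKahlerPotential (h : HermitianMetric n L) (φ : X → ℝ) : Prop :=
  ContMDiff 𝓘(ℝ, Fin n → ℂ) 𝓘(ℝ, ℝ) ∞ φ ∧
    ∀ c : X, ∀ z ∈ (chartAt (Fin n → ℂ) c).target, (metricMatrix h φ c z).PosDef

/-- A smooth path `φ_t`, `0 ≤ t ≤ 1`, in `P(X, ω)` from `0` to `φ`. A path that is smooth on
`[0, 1] × X` extends smoothly to `ℝ × X`, and is given here with such an extension, which is not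
required to take values in `P(X, ω)` for `t` outside `[0, 1]`. -/
structure KahlerPath (h : HermitianMetric n L) (φ : X → ℝ) where
  /-- the potentials `φ_t` -/
  pot : ℝ → X → ℝ
  smooth : ContMDiff (𝓘(ℝ, ℝ).prod 𝓘(ℝ, Fin n → ℂ)) 𝓘(ℝ, ℝ) ∞ fun p : ℝ × X => pot p.1 p.2
  source : pot 0 = 0
  target : pot 1 = φ
  mem : ∀ t ∈ Set.Icc (0 : ℝ) 1, IsKahlerPotential h (pot t)

/-- The matrix of forms `a R_{g_t} + b ∂g_t/∂t g_t⁻¹`. -/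
def tangentCurvature (h : HermitianMetric n L) (φ : ℝ → X → ℝ) (c : X) (z : Fin n → ℂ) (t : ℝ)
    (a b : ℂ) : Matrix (Fin n) (Fin n) (EvenForm n) :=
  a • curvature (metricMatrix h (φ t) c) z +
    b • degreeZero ((Matrix.of fun i j => deriv (fun s => metricMatrix h (φ s) c z i j) t) *
      (metricMatrix h (φ t) c z)⁻¹)

/-- The form `F + b ∂H_t/∂t H_t⁻¹` of the path of metrics `H_t = exp (-j φ_t) h^j` on `L^j`. -/
def powerCurvature (h : HermitianMetric n L) (φ : ℝ → X → ℝ) (c : X) (z : Fin n → ℂ) (t : ℝ)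
    (b : ℂ) (j : ℕ) : EvenForm n :=
  lineCurvature h (φ t) j c z + algebraMap ℂ (EvenForm n)
    (b * (lineVariation h φ j t ((chartAt (Fin n → ℂ) c).symm z) : ℂ))

/-- The top degree coefficient of `∂/∂b (Td(R_{g_t} + b ∂g_t/∂t g_t⁻¹) Ch(F_{H_t} + b ∂H_t/∂t H_t⁻¹))`
at `b = 0`. The product `Td · Ch` is a series of invariant polynomials, and it is differentiated
term by term; `r` is the degree of the polynomial. -/
def transgression (h : HermitianMetric n L) (ξ : Polynomial ℚ) (φ : ℝ → X → ℝ)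
    (c : X) (z : Fin n → ℂ) (t : ℝ) : ℂ :=
  ∑' r : ℕ, deriv (fun b : ℝ => topCoeff n (∑ pq ∈ Finset.HasAntidiagonal.antidiagonal r,
    todd pq.1 (tangentCurvature h φ c z t 1 b) *
      chernCharacter pq.2 ξ (powerCurvature h φ c z t b))) 0

/-- The functional `τ_X(ξ, φ)` of a virtual bundle `ξ = ∑ a_j L^j` with rational coefficients,
computed along a path from `0` to `φ`. -/
def tau [CompactSpace X] [T2Space X] (h : HermitianMetric n L) (ξ : Polynomial ℚ)
    {φ : X → ℝ} (p : KahlerPath h φ) : ℂ :=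
  (Complex.I / (2 * Real.pi)) ^ n *
    integral (fun (c : X) z => ∫ t in (0 : ℝ)..1, transgression h ξ p.pot c z t)

variable (n L) in
/-- The holomorphic sections of `L^m`. -/
def holSections (m : ℕ) : Submodule ℂ (∀ x, TensorPower ℂ m (L x)) where
  carrier := {s | ∀ x₀, ContMDiffOn 𝓘(ℂ, Fin n → ℂ) 𝓘(ℂ, ℂ) ω
    (fun y => PiTensorProduct.lift ((MultilinearMap.mkPiAlgebra ℂ (Fin m) ℂ).compLinearMap
      fun _ => (trivializationAt ℂ L x₀).linearMapAt ℂ y) (s y))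
    (trivializationAt ℂ L x₀).baseSet}
  add_mem' {s s'} hs hs' x₀ := by
    refine ((hs x₀).add (hs' x₀)).congr fun y _ => ?_
    simp only [Pi.add_apply, map_add]
  zero_mem' x₀ := by
    simpa only [Pi.zero_apply, map_zero] using contMDiffOn_const
  smul_mem' a s hs x₀ := by
    refine ((contMDiffOn_const (I' := 𝓘(ℂ, ℂ)) (c := a)).smul (hs x₀)).congr fun y _ => ?_
    simp only [Pi.smul_apply, map_smul, Pi.smul_apply']

variable (n L) in
/-- `χ` is the Hilbert polynomial: `χ(m) = dim H⁰(X, L^m)` for all large `m`. -/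
def IsHilbertPolynomial (χ : Polynomial ℚ) : Prop :=
  ∀ᶠ m : ℕ in Filter.atTop, χ.eval (m : ℚ) = Module.finrank ℂ (holSections n L m)

end LineBundle

/-! ## The coefficients `c_{l,k}` and the virtual bundles `E_l(m)` -/

/-- The coefficient of `m^{-l}` in the expansion of `m^k / (m χ(m))` at `m = ∞`. With `T = 1/m`
this is a Laurent series in `T`. If `w(m) = ∑ a_k m^k` then the coefficient of `m^{-l}` in
`w(m) / (m χ(m))` is `∑ c_{l,k} a_k`. -/
def cCoeff (χ : Polynomial ℚ) (l k : ℕ) : ℚ :=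
  ((HahnSeries.single (1 : ℤ) (1 : ℚ) : LaurentSeries ℚ)⁻¹ ^ k /
    ((HahnSeries.single (1 : ℤ) (1 : ℚ) : LaurentSeries ℚ)⁻¹ *
      Polynomial.aeval (HahnSeries.single (1 : ℤ) (1 : ℚ) : LaurentSeries ℚ)⁻¹ χ)).coeff (l : ℤ)

/-- `P_{k,l}(m) = ∑ (-1)^j binom(k, j) (m + j)^l`. -/
def diffPoly (k l m : ℕ) : ℚ :=
  ∑ j ∈ Finset.range (k + 1), (-1) ^ j * (k.choose j : ℚ) * ((m : ℚ) + j) ^ l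

/-- The upper triangular matrix of the linear system for `q_{n+1}(m), …, q_{n+1-l}(m)`. -/
def systemMatrix (n l m : ℕ) : Matrix (Fin (l + 1)) (Fin (l + 1)) ℚ :=
  Matrix.of fun a b => diffPoly (n + 1 - b) (n + 1 - a) m

theorem diffPoly_eq (k l m : ℕ) :
    diffPoly k l m = (-1) ^ k * ((fwdDiff (1 : ℚ))^[k] fun r : ℚ => r ^ l) m := by
  rw [fwdDiff_iter_eq_sum_shift, diffPoly, Finset.mul_sum]
  refine Finset.sum_congr rfl fun j hj => ?_
  have hj' : j ≤ k := Nat.lt_succ_iff.1 (Finset.mem_range.1 hj)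
  obtain ⟨d, rfl⟩ := Nat.exists_eq_add_of_le hj'
  have h1 : ((-1 : ℚ)) ^ d * (-1) ^ d = 1 := by rw [← mul_pow]; norm_num
  rw [Nat.add_sub_cancel_left, zsmul_eq_mul, pow_add]
  push_cast
  simp only [nsmul_eq_mul, mul_one]
  linear_combination -((-1) ^ j * ((j + d).choose j : ℚ) * ((m : ℚ) + j) ^ l) * h1

theorem systemMatrix_det_ne_zero {n l : ℕ} (hl : l ≤ n + 1) (m : ℕ) :
    (systemMatrix n l m).det ≠ 0 := by
  have htri : (systemMatrix n l m).BlockTriangular id := by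
    intro a b hab
    have hab' : (b : ℕ) < a := hab
    have ha := a.is_lt
    rw [systemMatrix, Matrix.of_apply, diffPoly_eq,
      fwdDiff_iter_pow_eq_zero_of_lt (by omega : n + 1 - (a : ℕ) < n + 1 - (b : ℕ))]
    simp
  rw [Matrix.det_of_isUpperTriangular htri, Finset.prod_ne_zero_iff]
  intro a _
  rw [systemMatrix, Matrix.of_apply, diffPoly_eq, fwdDiff_iter_eq_factorial]
  simp [Nat.factorial_ne_zero]

/-- The solution `(q_{n+1}(m), …, q_{n+1-l}(m))` of the system with right hand side
`(c_{l,n+1}, …, c_{l,n+1-l})`; the entry with index `j` is `q_{n+1-j}(m)`. -/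
def qCoeff (χ : Polynomial ℚ) (n l m : ℕ) : Fin (l + 1) → ℚ :=
  (systemMatrix n l m)⁻¹.mulVec fun a => cCoeff χ l (n + 1 - a)

theorem systemMatrix_mulVec_qCoeff (χ : Polynomial ℚ) {n l : ℕ} (hl : l ≤ n + 1) (m : ℕ) :
    (systemMatrix n l m).mulVec (qCoeff χ n l m) =
      fun a : Fin (l + 1) => cCoeff χ l (n + 1 - a) := by
  rw [qCoeff, Matrix.mulVec_mulVec, Matrix.mul_nonsing_inv _
    (isUnit_iff_ne_zero.2 (systemMatrix_det_ne_zero hl m)), Matrix.one_mulVec]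

/-- The virtual bundle `E_l(m)`, an element of `ℚ[L]`. -/
def virtualBundle (χ : Polynomial ℚ) (n l m : ℕ) : Polynomial ℚ :=
  ∑ j : Fin (l + 1), ∑ i ∈ Finset.range (n + 1 - j + 1),
    Polynomial.C (qCoeff χ n l m j * (-1) ^ i * ((n + 1 - j).choose i : ℚ)) *
      Polynomial.X ^ (m + i)

/-- The higher energy `F_{ω,l}(φ) = τ_X(E_l(m), φ)`, computed along a path from `0` to `φ`. -/
def higherEnergy {n : ℕ} {X : Type*} [TopologicalSpace X] [ChartedSpace (Fin n → ℂ) X]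
    [CompactSpace X] [T2Space X]
    {L : X → Type*} [∀ x, AddCommGroup (L x)] [∀ x, Module ℂ (L x)]
    [TopologicalSpace (Bundle.TotalSpace ℂ L)] [∀ x, TopologicalSpace (L x)]
    [FiberBundle ℂ L] [VectorBundle ℂ ℂ L]
    (h : HermitianMetric n L) (χ : Polynomial ℚ) (l m : ℕ) {φ : X → ℝ} (p : KahlerPath h φ) : ℂ :=
  tau h (virtualBundle χ n l m) p

end HigherEnergy

end

open HigherEnergy

/-! The identity holds pointwise before integration. Put `Ω = ∑ g_{ij} dz_i ∧ dz̄_j`. Since `log H_t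
= j (log h - φ_t)` on `L^j`, the curvature is `j Ω` and `∂H/∂t H⁻¹ = -j φ'`. Hence `Ch_k` of `∑ a_j
L^j` is `(∑ a_j j^k) (Ω - b φ')^k / k!` (`powerCurvature_eq`, `chernCharacter_smul`), and the
virtual bundle enters only through its moments `∑ a_j j^k`. For `E_l(m)` the moment is `c_{l,k}`
when `n+1-l ≤ k ≤ n+1`, by the linear system, and `0` for smaller `k`, because an iterated
difference of order above `k` kills `r^k`.

Moments with `k > n+1` never matter. Differentiating in `b` replaces one two-form by a function, so
a polynomial of degree `r` contributes a form of degree `2(r-1)`, and only `r = n+1` reaches the top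
degree (`topVariation_eq_zero`, `tsum_deriv_topCoeff`). The product rule then gives the two sums. In
the first one the term `k = n+1` drops out, since `Td_0 = 1` is constant. The factor `(√-1/2π)^n` is
absorbed by the algebra endomorphism multiplying two-forms by `√-1/2π`: it rescales `R` and `Ω`,
fixes `g' g⁻¹` and `φ'`, and multiplies top coefficients by `(√-1/2π)^n` (`topCoeff_scaleForm`).

Splitting the integral of the difference requires integrability. Both integrands are continuous on
`[0,1]` times a chart, which rests on the smoothness of `g_t`. The matrix `g_t` is defined with a
frame that moves with the point; holomorphic changes of frame alter `log h` by the pluriharmonic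
function `log |τ|²` (`hess_log_weight_eq`), so the frame may be frozen locally. -/

noncomputable section

namespace HigherEnergy

/-! ## Todd polynomials -/

section Todd

variable {A B : Type*} [CommRing A] [Algebra ℂ A] [CommRing B] [Algebra ℂ B]
  {ι : Type*} [Fintype ι] [DecidableEq ι]

/-- Naturality of the universal polynomial `Td_k` under algebra homomorphisms. It is applied to
evaluation at `b`, to rescaling of forms and to evaluation of continuous families. -/
theorem map_todd (f : A →ₐ[ℂ] B) (k : ℕ) (M : Matrix ι ι A) :
    f (todd k M) = todd k (M.map f) := by
  have h1 : f (todd k M) = PowerSeries.coeff k (PowerSeries.map (f : A →+* B) (Matrix.det (Matrix.of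
      fun i j : ι => PowerSeries.mk fun r =>
        ((bernoulli' r / (r.factorial : ℚ) : ℚ) : ℂ) • (M ^ r) i j))) := by
    rw [PowerSeries.coeff_map]; rfl
  rw [h1, RingHom.map_det, todd]
  congr 2
  ext i j r
  have : (M.map f) ^ r = (M ^ r).map f := (map_pow f.mapMatrix M r).symm
  simp [this]

theorem todd_zero (M : Matrix ι ι A) : todd 0 M = 1 := by
  rw [todd, PowerSeries.coeff_zero_eq_constantCoeff_apply, RingHom.map_det]
  convert Matrix.det_one (n := ι) (R := A)
  ext i j
  simp [Matrix.one_apply]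

/-- Replacing `M` by `a M` amounts to rescaling the power series variable by `a`. -/
theorem todd_smul (k : ℕ) (a : ℂ) (M : Matrix ι ι A) : todd k (a • M) = a ^ k • todd k M := by
  have h1 : Matrix.det (Matrix.of fun i j : ι => PowerSeries.mk fun r =>
        ((bernoulli' r / (r.factorial : ℚ) : ℚ) : ℂ) • ((a • M) ^ r) i j) =
      PowerSeries.rescale (algebraMap ℂ A a) (Matrix.det (Matrix.of fun i j : ι =>
        PowerSeries.mk fun r => ((bernoulli' r / (r.factorial : ℚ) : ℚ) : ℂ) • (M ^ r) i j)) := by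
    rw [RingHom.map_det]
    congr 1
    ext i j r
    simp only [Matrix.of_apply, PowerSeries.coeff_mk, RingHom.mapMatrix_apply, Matrix.map_apply,
      PowerSeries.coeff_rescale, smul_pow, Matrix.smul_apply]
    rw [smul_comm, ← map_pow, ← Algebra.smul_def]
  rw [todd, h1, PowerSeries.coeff_rescale, ← map_pow, ← Algebra.smul_def, todd]

open Polynomial in
/-- The polynomial `b ↦ Td_k(R + b G)`. -/
def toddLine (k : ℕ) (R G : Matrix ι ι A) : Polynomial A :=
  todd k (R.map C + (X : A[X]) • G.map C)

/-- The derivative of `b ↦ Td_k(R + b G)` at `b = 0`. -/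
def toddDeriv (k : ℕ) (R G : Matrix ι ι A) : A := (toddLine k R G).coeff 1

/-- Working over `A[X]` makes the dependence on `b` polynomial, so the derivative at `0` is a
coefficient and no topology on `A` is needed. -/
theorem eval_toddLine (k : ℕ) (R G : Matrix ι ι A) (b : ℂ) :
    (toddLine k R G).eval (algebraMap ℂ A b) = todd k (R + b • G) := by
  have := map_todd ((Polynomial.aeval (algebraMap ℂ A b) : Polynomial A →ₐ[A] A).restrictScalars ℂ) k
    (R.map Polynomial.C + (Polynomial.X : Polynomial A) • G.map Polynomial.C)
  rw [AlgHom.restrictScalars_apply, ← Polynomial.coe_aeval_eq_eval] at *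
  rw [toddLine, this]
  congr 1
  ext i j
  simp only [Matrix.map_apply, Matrix.add_apply, Matrix.smul_apply]
  simp [Algebra.smul_def]
  ring

theorem coeff_zero_toddLine (k : ℕ) (R G : Matrix ι ι A) :
    (toddLine k R G).coeff 0 = todd k R := by
  rw [Polynomial.coeff_zero_eq_eval_zero, ← map_zero (algebraMap ℂ A), eval_toddLine, zero_smul,
    add_zero]

theorem map_toddDeriv (f : A →ₐ[ℂ] B) (k : ℕ) (R G : Matrix ι ι A) :
    f (toddDeriv k R G) = toddDeriv k (R.map f) (G.map f) := by
  have := map_todd (Polynomial.mapAlgHom f) k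
    (R.map Polynomial.C + (Polynomial.X : Polynomial A) • G.map Polynomial.C)
  have h2 : f (toddDeriv k R G) = (Polynomial.mapAlgHom f (toddLine k R G)).coeff 1 := by
    simp [toddDeriv]
  rw [h2, toddLine, this, toddDeriv, toddLine]
  congr 2
  ext1 i j
  simp

theorem toddDeriv_zero (R G : Matrix ι ι A) : toddDeriv 0 R G = 0 := by
  rw [toddDeriv, toddLine, todd_zero, Polynomial.coeff_one]; simp

/-- The substitution `X ↦ a X` multiplies the linear coefficient by `a`. -/
theorem toddDeriv_smul_right (k : ℕ) (a : ℂ) (R G : Matrix ι ι A) :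
    toddDeriv k R (a • G) = a • toddDeriv k R G := by
  have := map_todd ((Polynomial.aeval (Polynomial.C (algebraMap ℂ A a) * Polynomial.X) :
    Polynomial A →ₐ[A] Polynomial A).restrictScalars ℂ) k
    (R.map Polynomial.C + (Polynomial.X : Polynomial A) • G.map Polynomial.C)
  have h3 : toddLine k R (a • G) =
      (toddLine k R G).comp (Polynomial.C (algebraMap ℂ A a) * Polynomial.X) := by
    rw [AlgHom.restrictScalars_apply, Polynomial.aeval_def, Polynomial.eval₂_eq_eval_map] at this
    rw [toddLine, toddLine, Polynomial.comp, Polynomial.eval₂_eq_eval_map]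
    refine Eq.trans ?_ this.symm
    congr 1
    ext1 i j
    simp only [Matrix.map_apply, Matrix.add_apply, Matrix.smul_apply]
    simp [Algebra.smul_def]
    ring
  rw [toddDeriv, h3, Polynomial.comp_C_mul_X_coeff, pow_one, mul_comm, ← Algebra.smul_def,
    toddDeriv]

theorem toddDeriv_smul (k : ℕ) (a : ℂ) (R G : Matrix ι ι A) :
    toddDeriv k (a • R) (a • G) = a ^ k • toddDeriv k R G := by
  rw [toddDeriv, toddLine, toddDeriv, toddLine, ← Polynomial.coeff_smul, ← todd_smul]
  congr 2
  ext1 i j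
  simp only [Matrix.map_apply, Matrix.add_apply, Matrix.smul_apply]
  simp [Algebra.smul_def]
  ring

theorem smul_toddDeriv_smul_left (k : ℕ) (a : ℂ) (R G : Matrix ι ι A) :
    a • toddDeriv k (a • R) G = a ^ k • toddDeriv k R G := by
  rw [← toddDeriv_smul_right, toddDeriv_smul]

/-- The derivative at `b = 0` of a linear form evaluated on a polynomial in `b`. -/
theorem hasDerivAt_linear_eval (ℓ : A →ₗ[ℂ] ℂ) (F : Polynomial A) :
    HasDerivAt (fun b : ℝ => ℓ (F.eval (algebraMap ℂ A b))) (ℓ (F.coeff 1)) 0 := by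
  induction F using Polynomial.induction_on' with
  | add p q hp hq =>
    simp only [Polynomial.eval_add, map_add, Polynomial.coeff_add]
    exact hp.add hq
  | monomial r a =>
    have h1 : (fun b : ℝ => ℓ ((Polynomial.monomial r a).eval (algebraMap ℂ A b))) =
        fun b : ℝ => (b : ℂ) ^ r * ℓ a := by
      ext b
      rw [Polynomial.eval_monomial, ← map_pow, mul_comm, ← Algebra.smul_def, map_smul, smul_eq_mul]
    rw [h1]
    have h2 := ((Complex.ofRealCLM.hasDerivAt (x := (0 : ℝ))).pow r).mul_const (ℓ a)
    refine h2.congr_deriv ?_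
    rw [Polynomial.coeff_monomial]
    rcases r with _ | _ | r <;> simp

end Todd

/-! ## Scaling of forms -/

section Scale

variable {n : ℕ}

/-- The automorphism of the algebra of even forms induced by multiplication by `a` on
two-forms. -/
def scaleForm (n : ℕ) (a : ℂ) : EvenForm n →ₐ[ℂ] EvenForm n :=
  CliffordAlgebra.even.lift (0 : QuadraticForm ℂ (Cotangent n))
    { bilin := a • (CliffordAlgebra.even.ι (0 : QuadraticForm ℂ (Cotangent n))).bilin
      -- Both relations of the even Clifford algebra have right-hand side zero because the quadratic
      -- form is zero, so they survive any rescaling.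
      contract := fun m => by
        rw [LinearMap.smul_apply, LinearMap.smul_apply, CliffordAlgebra.EvenHom.contract]
        simp
      contract_mid := fun m₁ m₂ m₃ => by
        simp only [LinearMap.smul_apply, smul_mul_smul_comm]
        rw [CliffordAlgebra.EvenHom.contract_mid]
        simp }

theorem scaleForm_bilin (a : ℂ) (u v : Cotangent n) :
    scaleForm n a ((CliffordAlgebra.even.ι (0 : QuadraticForm ℂ (Cotangent n))).bilin u v) =
      a • (CliffordAlgebra.even.ι (0 : QuadraticForm ℂ (Cotangent n))).bilin u v := by
  rw [scaleForm, CliffordAlgebra.even.lift_ι]; rfl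

theorem scaleForm_formOfMatrix (s : ℂ) (a : Matrix (Fin n) (Fin n) ℂ) :
    scaleForm n s (formOfMatrix a) = s • formOfMatrix a := by
  simp only [formOfMatrix, map_sum, map_smul, dzdzbar, scaleForm_bilin, Finset.smul_sum]
  simp only [smul_comm s]

/-- Scaling two-forms by `c²` is induced by scaling covectors by `c`, which gives access to the
action on alternating maps. -/
theorem val_scaleForm_sq (c : ℂ) (x : EvenForm n) :
    (scaleForm n (c ^ 2) x : ExteriorAlgebra ℂ (Cotangent n)) =
      ExteriorAlgebra.map (c • LinearMap.id) (x : ExteriorAlgebra ℂ (Cotangent n)) := by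
  have : ((CliffordAlgebra.even (0 : QuadraticForm ℂ (Cotangent n))).val.comp (scaleForm n (c ^ 2)))
      = ((ExteriorAlgebra.map (c • LinearMap.id) :
          ExteriorAlgebra ℂ (Cotangent n) →ₐ[ℂ] ExteriorAlgebra ℂ (Cotangent n)).comp
        (CliffordAlgebra.even (0 : QuadraticForm ℂ (Cotangent n))).val :
          EvenForm n →ₐ[ℂ] ExteriorAlgebra ℂ (Cotangent n)) := by
    apply CliffordAlgebra.even.algHom_ext
    ext1
    apply LinearMap.ext₂
    intro u v
    change (scaleForm n (c ^ 2) ((CliffordAlgebra.even.ι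
      (0 : QuadraticForm ℂ (Cotangent n))).bilin u v) : ExteriorAlgebra ℂ (Cotangent n)) =
      ExteriorAlgebra.map (c • LinearMap.id) (ExteriorAlgebra.ι ℂ u * ExteriorAlgebra.ι ℂ v)
    rw [scaleForm_bilin, map_mul, ExteriorAlgebra.map_apply_ι, ExteriorAlgebra.map_apply_ι]
    simp only [LinearMap.smul_apply, LinearMap.id_apply, map_smul, smul_mul_smul_comm, ← pow_two]
    rfl
  exact DFunLike.congr_fun this x

theorem topCoeff_scaleForm (a : ℂ) (x : EvenForm n) :
    topCoeff n (scaleForm n a x) = a ^ n * topCoeff n x := by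
  -- A complex square root of `a`: scaling covectors by `c` multiplies degree `2n` by `c^(2n) =
  -- a^n`, and `topCoeff` sees no other degree.
  obtain ⟨c, rfl⟩ := IsAlgClosed.exists_pow_nat_eq a (n := 2) (by norm_num)
  have key : ∀ f : ∀ i, (Cotangent n) [⋀^Fin i]→ₗ[ℂ] ℂ, (∀ i, i ≠ n * 2 → f i = 0) →
      (ExteriorAlgebra.liftAlternating (R := ℂ) f) ∘ₗ
        (ExteriorAlgebra.map (c • LinearMap.id)).toLinearMap =
      (c ^ 2) ^ n • ExteriorAlgebra.liftAlternating (R := ℂ) f := by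
    intro f hf
    apply ExteriorAlgebra.lhom_ext
    intro i
    ext v
    simp only [LinearMap.compAlternatingMap_apply, LinearMap.comp_apply, AlgHom.toLinearMap_apply,
      ExteriorAlgebra.map_apply_ιMulti, LinearMap.smul_apply,
      ExteriorAlgebra.liftAlternating_apply_ιMulti]
    by_cases hi : i = n * 2
    · subst hi
      have : ((c • LinearMap.id : Cotangent n →ₗ[ℂ] Cotangent n) ∘ v) = fun i => c • v i := rfl
      rw [this, AlternatingMap.map_smul_univ]
      simp [pow_mul, mul_comm n 2]
    · simp [hf i hi]
  have := DFunLike.congr_fun (key (Pi.single (n * 2)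
      ((Matrix.detRowAlternating (R := ℂ) (n := Fin n × Fin 2)).domDomCongr finProdFinEquiv))
      (fun i hi => Pi.single_eq_of_ne hi _)) (x : ExteriorAlgebra ℂ (Cotangent n))
  rw [LinearMap.comp_apply, AlgHom.toLinearMap_apply, ← val_scaleForm_sq] at this
  exact this

end Scale

/-! ## Moments of virtual bundles -/

section Moments

/-- The number `∑ a_j j^k` attached to `ξ = ∑ a_j T^j`. -/
def moment (k : ℕ) : Polynomial ℚ →ₗ[ℚ] ℚ :=
  Polynomial.lsum fun j => ((j : ℚ) ^ k) • LinearMap.id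

theorem moment_C_mul_X_pow (k : ℕ) (a : ℚ) (j : ℕ) :
    moment k (Polynomial.C a * Polynomial.X ^ j) = a * (j : ℚ) ^ k := by
  rw [moment, Polynomial.lsum_apply, Polynomial.C_mul_X_pow_eq_monomial]
  refine (Polynomial.sum_monomial_index a
    (fun i x => ((i : ℚ) ^ k • (LinearMap.id : ℚ →ₗ[ℚ] ℚ)) x) (map_zero _)).trans ?_
  simp [mul_comm]

/-- As `(j Y)^k = j^k Y^k`, the powers of `L` separate from the form. -/
theorem chernCharacter_smul {A : Type*} [CommRing A] [Algebra ℂ A] (k : ℕ) (ξ : Polynomial ℚ)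
    (Y : A) :
    chernCharacter k ξ (fun j => (j : ℂ) • Y) =
      (((moment k ξ : ℚ) : ℂ) / (k.factorial : ℂ)) • Y ^ k := by
  rw [chernCharacter, moment, Polynomial.lsum_apply, Polynomial.sum]
  push_cast
  rw [Finset.sum_div, Finset.sum_smul]
  refine Finset.sum_congr rfl fun j _ => ?_
  rw [smul_pow, smul_smul, smul_smul]
  congr 1
  simp
  ring

theorem moment_virtualBundle (χ : Polynomial ℚ) (n l m k : ℕ) :
    moment k (virtualBundle χ n l m) =
      ∑ j : Fin (l + 1), diffPoly (n + 1 - j) k m * qCoeff χ n l m j := by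
  simp only [virtualBundle, map_sum, moment_C_mul_X_pow, diffPoly, Finset.sum_mul]
  refine Finset.sum_congr rfl fun j _ => Finset.sum_congr rfl fun i _ => ?_
  push_cast
  ring

theorem moment_virtualBundle_of_le (χ : Polynomial ℚ) {n l k : ℕ} (hl : l ≤ n + 1) (m : ℕ)
    (h1 : n + 1 - l ≤ k) (h2 : k ≤ n + 1) :
    moment k (virtualBundle χ n l m) = cCoeff χ l k := by
  -- Row `n + 1 - k` of the system is the one whose right-hand side is `c_{l,k}`.
  have h := congrFun (systemMatrix_mulVec_qCoeff χ hl m) ⟨n + 1 - k, by omega⟩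
  have hk : n + 1 - (n + 1 - k) = k := by omega
  simp only [hk] at h
  rw [moment_virtualBundle, ← h, Matrix.mulVec, dotProduct]
  simp [systemMatrix, hk]

/-- Every difference occurring in `E_l(m)` has order `n+1-j ≥ n+1-l > k`, so it annihilates `r^k`.
-/
theorem moment_virtualBundle_of_lt (χ : Polynomial ℚ) {n l k : ℕ} (m : ℕ)
    (h1 : k < n + 1 - l) : moment k (virtualBundle χ n l m) = 0 := by
  rw [moment_virtualBundle]
  refine Finset.sum_eq_zero fun j _ => ?_
  have hj := j.is_lt
  rw [diffPoly_eq, fwdDiff_iter_pow_eq_zero_of_lt (by omega : k < n + 1 - (j : ℕ))]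
  simp

end Moments

/-! ## The component of top degree of the transgression -/

section Transgression

variable {n : ℕ} {R G : Matrix (Fin n) (Fin n) (EvenForm n)} {Ω : EvenForm n}

/-- The derivative at `b = 0` of the top coefficient of `Td_p(R + b G) (Ω - b f)^q`. -/
def topVariation (n : ℕ) (R G : Matrix (Fin n) (Fin n) (EvenForm n)) (Ω : EvenForm n) (f : ℂ)
    (p q : ℕ) : ℂ :=
  topCoeff n (toddDeriv p R G * Ω ^ q) -
    (q : ℂ) * topCoeff n (todd p R * algebraMap ℂ (EvenForm n) f * Ω ^ (q - 1))

open Polynomial in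
theorem coeff_one_toddLine_mul {A : Type*} [CommRing A] [Algebra ℂ A] {ι : Type*} [Fintype ι]
    [DecidableEq ι] (R G : Matrix ι ι A) (Ω a : A) (p q : ℕ) :
    (toddLine p R G * (C Ω - X * C a) ^ q).coeff 1 =
      toddDeriv p R G * Ω ^ q - q * (todd p R * a * Ω ^ (q - 1)) := by
  have h0 : ((C Ω - X * C a) ^ q).coeff 0 = Ω ^ q := by
    rw [coeff_zero_eq_eval_zero]; simp
  have h1 : ((C Ω - X * C a) ^ q).coeff 1 = -(q * Ω ^ (q - 1) * a) := by
    -- The linear coefficient is the value at `0` of the formal derivative.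
    have h := coeff_derivative ((C Ω - X * C a) ^ q) 0
    rw [coeff_zero_eq_eval_zero] at h
    simp only [derivative_pow, derivative_sub, derivative_mul, derivative_C, derivative_X] at h
    simp at h
    rw [X_mul_C]
    exact h.symm
  rw [mul_coeff_one, h0, h1, coeff_zero_toddLine, toddDeriv]
  ring

theorem hasDerivAt_topCoeff (R G : Matrix (Fin n) (Fin n) (EvenForm n)) (Ω : EvenForm n) (f : ℂ)
    (p q : ℕ) :
    HasDerivAt (fun b : ℝ => topCoeff n (todd p (R + (b : ℂ) • G) *
      (Ω + algebraMap ℂ (EvenForm n) ((b : ℂ) * -f)) ^ q)) (topVariation n R G Ω f p q) 0 := by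
  have h := hasDerivAt_linear_eval (topCoeff n)
    (toddLine p R G * (Polynomial.C Ω - Polynomial.X *
      Polynomial.C (algebraMap ℂ (EvenForm n) f)) ^ q)
  rw [coeff_one_toddLine_mul] at h
  refine (h.congr_deriv ?_).congr_of_eventuallyEq (Filter.Eventually.of_forall fun b => ?_)
  · rw [topVariation, map_sub]
    congr 1
    rw [← nsmul_eq_mul, map_nsmul, nsmul_eq_mul]
  · simp only [Polynomial.eval_mul, eval_toddLine, Polynomial.eval_pow, Polynomial.eval_sub,
      Polynomial.eval_C, Polynomial.eval_X]
    simp only [mul_neg, map_neg, map_mul, sub_eq_add_neg]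

theorem hasDerivAt_topCoeff_todd_mul (R G : Matrix (Fin n) (Fin n) (EvenForm n)) (Ω : EvenForm n)
    (p : ℕ) :
    HasDerivAt (fun b : ℝ => topCoeff n (todd p (R + (b : ℂ) • G) * Ω))
      (topCoeff n (toddDeriv p R G * Ω)) 0 := by
  have h := hasDerivAt_linear_eval (topCoeff n) (toddLine p R G * Polynomial.C Ω)
  rw [Polynomial.coeff_mul_C] at h
  simpa only [Polynomial.eval_mul, eval_toddLine, Polynomial.eval_C, toddDeriv] using h

/-- The rescaling of forms is an algebra homomorphism fixing functions, so it acts through `R` and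
`Ω` alone, while the top coefficient picks up `s^n`. -/
theorem pow_mul_topVariation (s : ℂ) (hR : R.map (scaleForm n s) = s • R)
    (hG : G.map (scaleForm n s) = G) (hΩ : scaleForm n s Ω = s • Ω) (f : ℂ) (p q : ℕ) :
    s ^ n * topVariation n R G Ω f p q = topVariation n (s • R) G (s • Ω) f p q := by
  rw [topVariation, mul_sub, mul_left_comm, ← topCoeff_scaleForm, ← topCoeff_scaleForm,
    topVariation]
  simp only [map_mul, map_pow, map_todd, map_toddDeriv, AlgHom.commutes, hR, hG, hΩ]

/-- Two ways of counting degree are compared. Rescaling forms by `2` gives `2^n V = V'`, where `V'`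
has `2R` and `2Ω` in place of `R` and `Ω`. Homogeneity of the polynomial, which is linear in `(G,
f)` after differentiation, gives `2 V' = 2^(p+q) V`. Hence `2^(n+1) V = 2^(p+q) V`. -/
theorem topVariation_eq_zero (hR : R.map (scaleForm n 2) = (2 : ℂ) • R)
    (hG : G.map (scaleForm n 2) = G) (hΩ : scaleForm n 2 Ω = (2 : ℂ) • Ω) (f : ℂ) {p q : ℕ}
    (hpq : p + q ≠ n + 1) : topVariation n R G Ω f p q = 0 := by
  have h := pow_mul_topVariation 2 hR hG hΩ f p q
  have h1 : (2 : ℂ) * topVariation n ((2 : ℂ) • R) G ((2 : ℂ) • Ω) f p q =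
      2 ^ (p + q) * topVariation n R G Ω f p q := by
    rw [topVariation, topVariation, mul_sub, ← smul_eq_mul (2 : ℂ) (topCoeff n _), ← map_smul,
      ← smul_mul_assoc, smul_toddDeriv_smul_left, smul_pow, smul_mul_smul_comm, map_smul,
      ← pow_add, smul_eq_mul, mul_sub, todd_smul]
    congr 1
    -- For `q = 0` the truncated exponent `q - 1` is harmless, since the factor `q` kills the term.
    rcases q with _ | q
    · simp
    · rw [Nat.add_sub_cancel, smul_pow, smul_mul_assoc, smul_mul_smul_comm, map_smul, smul_eq_mul]
      ring
  have h2 : (2 : ℂ) ^ (n + 1) * topVariation n R G Ω f p q =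
      2 ^ (p + q) * topVariation n R G Ω f p q := by
    rw [← h1, ← h]; ring
  by_contra h0
  have h3 := mul_right_cancel₀ h0 h2
  refine hpq (Nat.pow_right_injective le_rfl ?_).symm
  exact_mod_cast h3

theorem tsum_deriv_topCoeff (hR : R.map (scaleForm n 2) = (2 : ℂ) • R)
    (hG : G.map (scaleForm n 2) = G) (hΩ : scaleForm n 2 Ω = (2 : ℂ) • Ω) (f : ℂ) (d : ℕ → ℂ) :
    ∑' r : ℕ, deriv (fun b : ℝ => topCoeff n (∑ pq ∈ Finset.HasAntidiagonal.antidiagonal r,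
      todd pq.1 (R + (b : ℂ) • G) *
        (d pq.2 • (Ω + algebraMap ℂ (EvenForm n) ((b : ℂ) * -f)) ^ pq.2))) 0 =
      ∑ q ∈ Finset.range (n + 2), d q * topVariation n R G Ω f (n + 1 - q) q := by
  have h1 : ∀ r : ℕ, deriv (fun b : ℝ => topCoeff n (∑ pq ∈ Finset.HasAntidiagonal.antidiagonal r,
      todd pq.1 (R + (b : ℂ) • G) *
        (d pq.2 • (Ω + algebraMap ℂ (EvenForm n) ((b : ℂ) * -f)) ^ pq.2))) 0 =
      ∑ pq ∈ Finset.HasAntidiagonal.antidiagonal r, d pq.2 * topVariation n R G Ω f pq.1 pq.2 := by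
    intro r
    refine HasDerivAt.deriv ?_
    simp only [map_sum, mul_smul_comm, map_smul, smul_eq_mul]
    exact HasDerivAt.fun_sum fun pq _ => (hasDerivAt_topCoeff R G Ω f pq.1 pq.2).const_mul _
  simp only [h1]
  rw [tsum_eq_single (n + 1)]
  · rw [Finset.Nat.antidiagonal_eq_map', Finset.sum_map]
    rfl
  · intro r hr
    refine Finset.sum_eq_zero fun pq hpq => ?_
    rw [Finset.HasAntidiagonal.mem_antidiagonal] at hpq
    rw [topVariation_eq_zero hR hG hΩ f (hpq ▸ hr), mul_zero]

end Transgression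

/-! ## Calculus of the Wirtinger derivatives -/

section Wirtinger

variable {n : ℕ}

theorem wirt_congr {f g : (Fin n → ℂ) → ℂ} {z : Fin n → ℂ} (k : Fin n) (h : f =ᶠ[𝓝 z] g) :
    wirt k f z = wirt k g z := by
  rw [wirt, wirt, h.fderiv_eq]

theorem wirtBar_congr {f g : (Fin n → ℂ) → ℂ} {z : Fin n → ℂ} (k : Fin n) (h : f =ᶠ[𝓝 z] g) :
    wirtBar k f z = wirtBar k g z := by
  rw [wirtBar, wirtBar, h.fderiv_eq]

theorem wirtBar_eventuallyEq {f g : (Fin n → ℂ) → ℂ} {z : Fin n → ℂ} (k : Fin n)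
    (h : f =ᶠ[𝓝 z] g) : wirtBar k f =ᶠ[𝓝 z] wirtBar k g := by
  filter_upwards [h.eventuallyEq_nhds] with w hw using wirtBar_congr k hw

theorem hess_congr {f g : (Fin n → ℂ) → ℂ} {z : Fin n → ℂ} (h : f =ᶠ[𝓝 z] g) :
    hess f z = hess g z := by
  ext i j
  exact wirt_congr i (wirtBar_eventuallyEq j h)

theorem wirt_add {f g : (Fin n → ℂ) → ℂ} {z : Fin n → ℂ} (k : Fin n)
    (hf : DifferentiableAt ℝ f z) (hg : DifferentiableAt ℝ g z) :
    wirt k (fun w => f w + g w) z = wirt k f z + wirt k g z := by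
  simp only [wirt, fderiv_fun_add hf hg, add_apply]
  ring

theorem wirtBar_add {f g : (Fin n → ℂ) → ℂ} {z : Fin n → ℂ} (k : Fin n)
    (hf : DifferentiableAt ℝ f z) (hg : DifferentiableAt ℝ g z) :
    wirtBar k (fun w => f w + g w) z = wirtBar k f z + wirtBar k g z := by
  simp only [wirtBar, fderiv_fun_add hf hg, add_apply]
  ring

theorem wirt_const_mul {f : (Fin n → ℂ) → ℂ} {z : Fin n → ℂ} (k : Fin n) (a : ℂ)
    (hf : DifferentiableAt ℝ f z) : wirt k (fun w => a * f w) z = a * wirt k f z := by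
  simp only [wirt, fderiv_const_mul hf, smul_apply, smul_eq_mul]
  ring

theorem wirtBar_const_mul {f : (Fin n → ℂ) → ℂ} {z : Fin n → ℂ} (k : Fin n) (a : ℂ)
    (hf : DifferentiableAt ℝ f z) : wirtBar k (fun w => a * f w) z = a * wirtBar k f z := by
  simp only [wirtBar, fderiv_const_mul hf, smul_apply, smul_eq_mul]
  ring

theorem differentiableAt_fderiv_apply {f : (Fin n → ℂ) → ℂ} {z : Fin n → ℂ}
    (hf : ContDiffAt ℝ 2 f z) (v : Fin n → ℂ) :
    DifferentiableAt ℝ (fun w => fderiv ℝ f w v) z :=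
  ((hf.fderiv_right (m := 1) (by norm_num)).differentiableAt (by norm_num)).clm_apply
    (differentiableAt_const v)

theorem differentiableAt_wirtBar {f : (Fin n → ℂ) → ℂ} {z : Fin n → ℂ}
    (hf : ContDiffAt ℝ 2 f z) (k : Fin n) : DifferentiableAt ℝ (wirtBar k f) z :=
  ((differentiableAt_fderiv_apply hf _).add ((differentiableAt_fderiv_apply hf _).const_mul _)).const_mul _

theorem eventually_differentiableAt {f : (Fin n → ℂ) → ℂ} {z : Fin n → ℂ}
    (hf : ContDiffAt ℝ 2 f z) : ∀ᶠ w in 𝓝 z, DifferentiableAt ℝ f w :=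
  (hf.eventually (by norm_num)).mono fun _ hw => hw.differentiableAt (by norm_num)

theorem hess_add {f g : (Fin n → ℂ) → ℂ} {z : Fin n → ℂ} (hf : ContDiffAt ℝ 2 f z)
    (hg : ContDiffAt ℝ 2 g z) : hess (fun w => f w + g w) z = hess f z + hess g z := by
  ext i j
  simp only [hess, Matrix.of_apply, Matrix.add_apply]
  rw [← wirt_add i (differentiableAt_wirtBar hf j) (differentiableAt_wirtBar hg j)]
  refine wirt_congr i ?_
  filter_upwards [eventually_differentiableAt hf, eventually_differentiableAt hg] with w h1 h2
  exact wirtBar_add j h1 h2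

theorem hess_const_mul {f : (Fin n → ℂ) → ℂ} {z : Fin n → ℂ} (a : ℂ) (hf : ContDiffAt ℝ 2 f z) :
    hess (fun w => a * f w) z = a • hess f z := by
  ext i j
  simp only [hess, Matrix.of_apply, Matrix.smul_apply, smul_eq_mul]
  rw [← wirt_const_mul i a (differentiableAt_wirtBar hf j)]
  refine wirt_congr i ?_
  filter_upwards [eventually_differentiableAt hf] with w h1
  exact wirtBar_const_mul j a h1

/-- The real part of a holomorphic function is pluriharmonic. -/
theorem hess_re_eq_zero {u : (Fin n → ℂ) → ℂ} {z : Fin n → ℂ} (hu : ContDiffAt ℂ 2 u z) :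
    hess (fun w => ((u w).re : ℂ)) z = 0 := by
  have hsmul : ∀ (k : Fin n), (Pi.single k Complex.I : Fin n → ℂ) =
      Complex.I • (Pi.single k 1 : Fin n → ℂ) := fun k => by
    rw [← Pi.single_smul, smul_eq_mul, mul_one]
  -- `∂̄_j Re u` is half the conjugate of `∂_j u`; being antiholomorphic, it is then killed by
  -- `∂_i`.
  have h1 : ∀ j : Fin n, wirtBar j (fun w => ((u w).re : ℂ)) =ᶠ[𝓝 z]
      fun w => (1 / 2) * starRingEnd ℂ (fderiv ℂ u w (Pi.single j 1)) := by
    intro j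
    filter_upwards [hu.eventually (by norm_num)] with w hw
    have hd : HasFDerivAt (fun w => ((u w).re : ℂ))
        (Complex.ofRealCLM.comp (Complex.reCLM.comp ((fderiv ℂ u w).restrictScalars ℝ))) w :=
      Complex.ofRealCLM.hasFDerivAt.comp w (Complex.reCLM.hasFDerivAt.comp w
        ((hw.differentiableAt (by norm_num)).hasFDerivAt.restrictScalars ℝ))
    rw [wirtBar, hd.fderiv, hsmul]
    simp only [ContinuousLinearMap.comp_apply, ContinuousLinearMap.coe_restrictScalars', map_smul]
    generalize fderiv ℂ u w (Pi.single j 1) = a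
    apply Complex.ext <;> simp
  ext i j
  have hv : DifferentiableAt ℂ (fun w => fderiv ℂ u w (Pi.single j 1)) z :=
    ((hu.fderiv_right (m := 1) (by norm_num)).differentiableAt (by norm_num)).clm_apply
      (differentiableAt_const _)
  have hd : HasFDerivAt (fun w => starRingEnd ℂ (fderiv ℂ u w (Pi.single j 1)))
      ((Complex.conjCLE : ℂ →L[ℝ] ℂ).comp
        ((fderiv ℂ (fun w => fderiv ℂ u w (Pi.single j 1)) z).restrictScalars ℝ)) z :=
    (Complex.conjCLE : ℂ →L[ℝ] ℂ).hasFDerivAt.comp z (hv.hasFDerivAt.restrictScalars ℝ)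
  rw [hess, Matrix.of_apply, wirt_congr i (h1 j), wirt_const_mul i _ hd.differentiableAt, wirt,
    hd.fderiv, hsmul]
  simp only [ContinuousLinearMap.comp_apply, ContinuousLinearMap.coe_restrictScalars', map_smul]
  generalize fderiv ℂ (fun w => fderiv ℂ u w (Pi.single j 1)) z (Pi.single i 1) = a
  simp [← mul_assoc]

theorem hess_log_norm_sq_eq_zero {τ : (Fin n → ℂ) → ℂ} {z : Fin n → ℂ} (hτ : ContDiffAt ℂ 2 τ z)
    (h0 : τ z ≠ 0) : hess (fun w => (Real.log (‖τ w‖ ^ 2) : ℂ)) z = 0 := by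
  -- Near `z`, `log |τ|²` is the real part of this holomorphic function. Dividing by `τ z` puts the
  -- value at `1`, away from the cut of the principal logarithm.
  have hu : ContDiffAt ℂ 2 (fun w => 2 * Complex.log (τ w / τ z) +
      (Real.log (‖τ z‖ ^ 2) : ℂ)) z := by
    refine (contDiffAt_const.mul ?_).add contDiffAt_const
    refine ContDiffAt.comp z (Complex.contDiffAt_log ?_) (hτ.div_const _)
    rw [div_self h0]
    exact Complex.one_mem_slitPlane
  rw [← hess_re_eq_zero hu]
  refine hess_congr ?_
  filter_upwards [hτ.continuousAt.eventually_ne h0] with w hw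
  congr 1
  have h1 : ‖τ w‖ ≠ 0 := norm_ne_zero_iff.2 hw
  have h2 : ‖τ z‖ ≠ 0 := norm_ne_zero_iff.2 h0
  simp only [Complex.add_re, Complex.ofReal_re, Complex.mul_re, Complex.re_ofNat, Complex.im_ofNat,
    zero_mul, sub_zero, Complex.log_re, norm_div, Real.log_div h1 h2, Real.log_pow]
  push_cast
  ring

/-! ### Dependence on a parameter -/

variable {W : Set (ℝ × (Fin n → ℂ))} {F : ℝ × (Fin n → ℂ) → ℂ}

/-- The partial derivative along `v` is the full derivative in the direction `(0, v)`, hence jointly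
smooth in the parameter and the point. -/
theorem contDiffOn_fderiv_snd (hW : IsOpen W) (hF : ContDiffOn ℝ ∞ F W) (v : Fin n → ℂ) :
    ContDiffOn ℝ ∞ (fun p => fderiv ℝ (fun w => F (p.1, w)) p.2 v) W := by
  have h1 : ContDiffOn ℝ ∞ (fun p => fderiv ℝ F p ((0 : ℝ), v)) W :=
    (hF.fderiv_of_isOpen hW (m := ∞) (by norm_num)).clm_apply contDiffOn_const
  refine h1.congr fun p hp => ?_
  have hd : HasFDerivAt F (fderiv ℝ F (p.1, p.2)) (p.1, p.2) :=
    ((hF.contDiffAt (hW.mem_nhds hp)).differentiableAt (by norm_num)).hasFDerivAt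
  have h2 := hd.comp p.2 (hasFDerivAt_prodMk_right p.1 p.2)
  change fderiv ℝ (F ∘ fun w => (p.1, w)) p.2 v = _
  rw [h2.fderiv]
  rfl

theorem contDiffOn_deriv_fst (hW : IsOpen W) (hF : ContDiffOn ℝ ∞ F W) :
    ContDiffOn ℝ ∞ (fun p => deriv (fun s => F (s, p.2)) p.1) W := by
  have h1 : ContDiffOn ℝ ∞ (fun p => fderiv ℝ F p ((1 : ℝ), 0)) W :=
    (hF.fderiv_of_isOpen hW (m := ∞) (by norm_num)).clm_apply contDiffOn_const
  refine h1.congr fun p hp => ?_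
  have hd : HasFDerivAt F (fderiv ℝ F (p.1, p.2)) (p.1, p.2) :=
    ((hF.contDiffAt (hW.mem_nhds hp)).differentiableAt (by norm_num)).hasFDerivAt
  have h2 := (hd.comp p.1 (hasFDerivAt_prodMk_left p.1 p.2)).hasDerivAt
  change deriv (F ∘ fun s => (s, p.2)) p.1 = _
  rw [h2.deriv]
  rfl

theorem contDiffOn_wirt (hW : IsOpen W) (hF : ContDiffOn ℝ ∞ F W) (k : Fin n) :
    ContDiffOn ℝ ∞ (fun p => wirt k (fun w => F (p.1, w)) p.2) W :=
  contDiffOn_const.mul ((contDiffOn_fderiv_snd hW hF _).sub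
    (contDiffOn_const.mul (contDiffOn_fderiv_snd hW hF _)))

theorem contDiffOn_wirtBar (hW : IsOpen W) (hF : ContDiffOn ℝ ∞ F W) (k : Fin n) :
    ContDiffOn ℝ ∞ (fun p => wirtBar k (fun w => F (p.1, w)) p.2) W :=
  contDiffOn_const.mul ((contDiffOn_fderiv_snd hW hF _).add
    (contDiffOn_const.mul (contDiffOn_fderiv_snd hW hF _)))

theorem contDiffOn_hess (hW : IsOpen W) (hF : ContDiffOn ℝ ∞ F W) (i j : Fin n) :
    ContDiffOn ℝ ∞ (fun p => hess (fun w => F (p.1, w)) p.2 i j) W :=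
  contDiffOn_wirt hW (contDiffOn_wirtBar hW hF j) i

end Wirtinger

/-! ## Weights of Hermitian metrics in holomorphic charts -/

section Weights

variable {n : ℕ} {X : Type*} [TopologicalSpace X] [ChartedSpace (Fin n → ℂ) X]

theorem isManifold_real [IsManifold 𝓘(ℂ, Fin n → ℂ) ω X] :
    IsManifold 𝓘(ℝ, Fin n → ℂ) ∞ X := by
  refine isManifold_of_contDiffOn _ _ _ fun e e' he he' => ?_
  have h := (contDiffGroupoid ω 𝓘(ℂ, Fin n → ℂ)).compatible he he'
  rw [contDiffGroupoid, mem_groupoid_of_pregroupoid] at h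
  exact (ContDiffOn.restrict_scalars ℝ h.1).of_le le_top

variable {L : X → Type*} [∀ x, AddCommGroup (L x)] [∀ x, Module ℂ (L x)]
  [TopologicalSpace (Bundle.TotalSpace ℂ L)] [∀ x, TopologicalSpace (L x)]
  [FiberBundle ℂ L] [VectorBundle ℂ ℂ L]

variable (L) in
/-- The function `τ` with `frame L x₀ = τ • frame L x₁`. -/
def frameChange (x₀ x₁ y : X) : ℂ :=
  (trivializationAt ℂ L x₀).coordChangeL ℂ (trivializationAt ℂ L x₁) y (1 : ℂ)

theorem frame_eq_smul {x₀ x₁ y : X} (h0 : y ∈ (trivializationAt ℂ L x₀).baseSet)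
    (h1 : y ∈ (trivializationAt ℂ L x₁).baseSet) :
    frame L x₀ y = frameChange L x₀ x₁ y • frame L x₁ y := by
  have h2 : frame L x₁ y = (trivializationAt ℂ L x₁).symmₗ ℂ y 1 :=
    ((trivializationAt ℂ L x₁).symmₗ_apply (R := ℂ) h1 1).symm
  rw [h2, ← map_smul, smul_eq_mul, mul_one, Bundle.Trivialization.symmₗ_apply _ h1, frameChange,
    Bundle.Trivialization.coordChangeL_apply _ _ ⟨h0, h1⟩]
  exact ((trivializationAt ℂ L x₁).symm_proj_apply ⟨y, frame L x₀ y⟩ h1).symm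

theorem frame_ne_zero {x₀ y : X} (h0 : y ∈ (trivializationAt ℂ L x₀).baseSet) :
    frame L x₀ y ≠ 0 := by
  intro h
  have h1 := (trivializationAt ℂ L x₀).linearMapAt_symm (R := ℂ) h0 1
  rw [frame] at h
  rw [h, map_zero] at h1
  exact zero_ne_one h1

theorem frameChange_ne_zero {x₀ x₁ y : X} (h0 : y ∈ (trivializationAt ℂ L x₀).baseSet)
    (h1 : y ∈ (trivializationAt ℂ L x₁).baseSet) : frameChange L x₀ x₁ y ≠ 0 := by
  intro h
  refine frame_ne_zero h0 ?_
  rw [frame_eq_smul h0 h1, h, zero_smul]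

theorem weight_pos (h : HermitianMetric n L) {x₀ y : X}
    (h0 : y ∈ (trivializationAt ℂ L x₀).baseSet) : 0 < h.weight x₀ y :=
  h.pos y _ (frame_ne_zero h0)

theorem weight_eq_mul (h : HermitianMetric n L) {x₀ x₁ y : X}
    (h0 : y ∈ (trivializationAt ℂ L x₀).baseSet) (h1 : y ∈ (trivializationAt ℂ L x₁).baseSet) :
    h.weight x₀ y = ‖frameChange L x₀ x₁ y‖ ^ 2 * h.weight x₁ y := by
  rw [HermitianMetric.weight, frame_eq_smul h0 h1, map_smulₛₗ, map_smulₛₗ, LinearMap.smul_apply,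
    smul_smul, RingHom.id_apply, mul_comm (frameChange L x₀ x₁ y), ← Complex.normSq_eq_conj_mul_self, smul_eq_mul, Complex.re_ofReal_mul,
    Complex.normSq_eq_norm_sq, HermitianMetric.weight]

variable [IsManifold 𝓘(ℂ, Fin n → ℂ) ω X]

omit [VectorBundle ℂ ℂ L] in
theorem contDiffAt_weight (h : HermitianMetric n L) {c x₀ : X} {z : Fin n → ℂ}
    (hz : z ∈ (chartAt (Fin n → ℂ) c).target)
    (h0 : (chartAt (Fin n → ℂ) c).symm z ∈ (trivializationAt ℂ L x₀).baseSet) :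
    ContDiffAt ℝ ∞ (fun w => h.weight x₀ ((chartAt (Fin n → ℂ) c).symm w)) z := by
  have : IsManifold 𝓘(ℝ, Fin n → ℂ) ∞ X := isManifold_real
  have h1 : ContMDiffAt 𝓘(ℝ, Fin n → ℂ) 𝓘(ℝ, ℝ) ∞ (h.weight x₀)
      ((chartAt (Fin n → ℂ) c).symm z) :=
    (h.smooth x₀).contMDiffAt ((trivializationAt ℂ L x₀).open_baseSet.mem_nhds h0)
  have h2 : ContMDiffAt 𝓘(ℝ, Fin n → ℂ) 𝓘(ℝ, Fin n → ℂ) ∞ (chartAt (Fin n → ℂ) c).symm z :=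
    contMDiffOn_chart_symm.contMDiffAt ((chartAt (Fin n → ℂ) c).open_target.mem_nhds hz)
  exact (h1.comp z h2).contDiffAt

theorem contDiffAt_log_weight (h : HermitianMetric n L) {c x₀ : X} {z : Fin n → ℂ}
    (hz : z ∈ (chartAt (Fin n → ℂ) c).target)
    (h0 : (chartAt (Fin n → ℂ) c).symm z ∈ (trivializationAt ℂ L x₀).baseSet) :
    ContDiffAt ℝ ∞ (fun w => (Real.log (h.weight x₀ ((chartAt (Fin n → ℂ) c).symm w)) : ℂ)) z :=
  Complex.ofRealCLM.contDiff.contDiffAt.comp z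
    ((contDiffAt_weight h hz h0).log (weight_pos h h0).ne')

omit [∀ x, AddCommGroup (L x)] [∀ x, Module ℂ (L x)] [VectorBundle ℂ ℂ L] [IsManifold 𝓘(ℂ, Fin n → ℂ) ω X] in
theorem eventually_symm_mem {c x₀ : X} {z : Fin n → ℂ}
    (hz : z ∈ (chartAt (Fin n → ℂ) c).target)
    (h0 : (chartAt (Fin n → ℂ) c).symm z ∈ (trivializationAt ℂ L x₀).baseSet) :
    ∀ᶠ w in 𝓝 z, (chartAt (Fin n → ℂ) c).symm w ∈ (trivializationAt ℂ L x₀).baseSet :=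
  ((chartAt (Fin n → ℂ) c).continuousAt_symm hz).eventually
    ((trivializationAt ℂ L x₀).open_baseSet.mem_nhds h0)

variable [ContMDiffVectorBundle ω ℂ L 𝓘(ℂ, Fin n → ℂ)]

theorem contDiffAt_frameChange {c x₀ x₁ : X} {z : Fin n → ℂ}
    (hz : z ∈ (chartAt (Fin n → ℂ) c).target)
    (h0 : (chartAt (Fin n → ℂ) c).symm z ∈ (trivializationAt ℂ L x₀).baseSet)
    (h1 : (chartAt (Fin n → ℂ) c).symm z ∈ (trivializationAt ℂ L x₁).baseSet) :
    ContDiffAt ℂ ω (fun w => frameChange L x₀ x₁ ((chartAt (Fin n → ℂ) c).symm w)) z := by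
  have h2 : ContMDiffAt 𝓘(ℂ, Fin n → ℂ) 𝓘(ℂ, Fin n → ℂ) ω (chartAt (Fin n → ℂ) c).symm z :=
    contMDiffOn_chart_symm.contMDiffAt ((chartAt (Fin n → ℂ) c).open_target.mem_nhds hz)
  have h3 := (contMDiffAt_coordChangeL (n := ω) (IB := 𝓘(ℂ, Fin n → ℂ)) h0 h1).comp z h2
  exact h3.contDiffAt.clm_apply contDiffAt_const

/-- The curvature of `h` does not depend on the frame. -/
theorem hess_log_weight_eq (h : HermitianMetric n L) {c x₀ x₁ : X} {z : Fin n → ℂ}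
    (hz : z ∈ (chartAt (Fin n → ℂ) c).target)
    (h0 : (chartAt (Fin n → ℂ) c).symm z ∈ (trivializationAt ℂ L x₀).baseSet)
    (h1 : (chartAt (Fin n → ℂ) c).symm z ∈ (trivializationAt ℂ L x₁).baseSet) :
    hess (fun w => (Real.log (h.weight x₀ ((chartAt (Fin n → ℂ) c).symm w)) : ℂ)) z =
      hess (fun w => (Real.log (h.weight x₁ ((chartAt (Fin n → ℂ) c).symm w)) : ℂ)) z := by
  have hτ := contDiffAt_frameChange hz h0 h1
  have hne := frameChange_ne_zero h0 h1
  have h2 : (fun w => (Real.log (h.weight x₀ ((chartAt (Fin n → ℂ) c).symm w)) : ℂ)) =ᶠ[𝓝 z]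
      fun w => (Real.log (‖frameChange L x₀ x₁ ((chartAt (Fin n → ℂ) c).symm w)‖ ^ 2) : ℂ) +
        (Real.log (h.weight x₁ ((chartAt (Fin n → ℂ) c).symm w)) : ℂ) := by
    filter_upwards [eventually_symm_mem hz h0, eventually_symm_mem hz h1] with w hw0 hw1
    rw [weight_eq_mul h hw0 hw1, Real.log_mul
      (pow_ne_zero 2 (norm_ne_zero_iff.2 (frameChange_ne_zero hw0 hw1))) (weight_pos h hw1).ne']
    push_cast
    rfl
  have h3 : ContDiffAt ℝ 2 (fun w =>
      (Real.log (‖frameChange L x₀ x₁ ((chartAt (Fin n → ℂ) c).symm w)‖ ^ 2) : ℂ)) z :=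
    Complex.ofRealCLM.contDiff.contDiffAt.comp z
      ((((hτ.restrict_scalars ℝ).of_le le_top).norm_sq ℝ).log
        (pow_ne_zero 2 (norm_ne_zero_iff.2 hne)))
  rw [hess_congr h2, hess_add h3 ((contDiffAt_log_weight h hz h1).of_le (by norm_cast)),
    hess_log_norm_sq_eq_zero (hτ.of_le le_top) hne, zero_add]

end Weights

/-! ## Linear algebra of forms -/

section Forms

variable {n : ℕ}

theorem formOfMatrix_smul (s : ℂ) (a : Matrix (Fin n) (Fin n) ℂ) :
    formOfMatrix (s • a) = s • formOfMatrix a := by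
  simp only [formOfMatrix, Matrix.smul_apply, Finset.smul_sum, smul_assoc]

theorem formOfMatrix_neg (a : Matrix (Fin n) (Fin n) ℂ) :
    formOfMatrix (-a) = -formOfMatrix a := by
  simp only [formOfMatrix, Matrix.neg_apply, neg_smul, Finset.sum_neg_distrib]

theorem map_scaleForm_curvature (s : ℂ) (g : (Fin n → ℂ) → Matrix (Fin n) (Fin n) ℂ)
    (z : Fin n → ℂ) : (curvature g z).map (scaleForm n s) = s • curvature g z := by
  ext1 i j
  simp only [curvature, Matrix.map_apply, Matrix.of_apply, map_neg, scaleForm_formOfMatrix,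
    Matrix.smul_apply, smul_neg]

theorem map_scaleForm_degreeZero (s : ℂ) (a : Matrix (Fin n) (Fin n) ℂ) :
    (degreeZero a).map (scaleForm n s) = degreeZero a := by
  ext1 i j
  simp only [degreeZero, Matrix.map_apply, AlgHom.commutes]

end Forms

/-! ## Smoothness of the metric and of its curvature; the transgression at a point -/

section Determinant

variable {E : Type*} [NormedAddCommGroup E] [NormedSpace ℝ E] {W : Set E}
  {ι : Type*} [Fintype ι] [DecidableEq ι] {M : E → Matrix ι ι ℂ}

theorem contDiffOn_det (hM : ∀ i j, ContDiffOn ℝ ∞ (fun q => M q i j) W) :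
    ContDiffOn ℝ ∞ (fun q => (M q).det) W := by
  simp only [Matrix.det_apply]
  exact ContDiffOn.sum fun σ _ => (contDiffOn_prod fun i _ => hM _ _).const_smul _

theorem contDiffOn_inv_apply (hM : ∀ i j, ContDiffOn ℝ ∞ (fun q => M q i j) W)
    (hdet : ∀ q ∈ W, (M q).det ≠ 0) (i j : ι) :
    ContDiffOn ℝ ∞ (fun q => (M q)⁻¹ i j) W := by
  simp only [Matrix.inv_def, Matrix.smul_apply, Ring.inverse_eq_inv', smul_eq_mul,
    Matrix.adjugate_apply]
  refine ((contDiffOn_det hM).inv hdet).mul (contDiffOn_det fun a b => ?_)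
  by_cases h : a = j
  · subst h
    simp only [Matrix.updateRow_self]
    exact contDiffOn_const
  · simp only [Matrix.updateRow_ne h]
    exact hM a b

omit [DecidableEq ι] in
theorem contDiffOn_mul_apply {N : E → Matrix ι ι ℂ}
    (hM : ∀ i j, ContDiffOn ℝ ∞ (fun q => M q i j) W)
    (hN : ∀ i j, ContDiffOn ℝ ∞ (fun q => N q i j) W) (i j : ι) :
    ContDiffOn ℝ ∞ (fun q => (M q * N q) i j) W := by
  simp only [Matrix.mul_apply]
  exact ContDiffOn.sum fun k _ => (hM i k).mul (hN k j)

end Determinant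

/-! ### The path of metrics in a holomorphic chart. -/

section Metric

variable {n : ℕ} {X : Type*} [TopologicalSpace X] [ChartedSpace (Fin n → ℂ) X]
  {L : X → Type*} [∀ x, AddCommGroup (L x)] [∀ x, Module ℂ (L x)]
  [TopologicalSpace (Bundle.TotalSpace ℂ L)] [∀ x, TopologicalSpace (L x)]
  [FiberBundle ℂ L] [VectorBundle ℂ ℂ L] [IsManifold 𝓘(ℂ, Fin n → ℂ) ω X]

theorem contDiffAt_potential {φ : ℝ → X → ℝ}
    (hφ : ContMDiff (𝓘(ℝ, ℝ).prod 𝓘(ℝ, Fin n → ℂ)) 𝓘(ℝ, ℝ) ∞ fun p : ℝ × X => φ p.1 p.2)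
    {c : X} {q : ℝ × (Fin n → ℂ)} (hq : q.2 ∈ (chartAt (Fin n → ℂ) c).target) :
    ContDiffAt ℝ ∞ (fun q : ℝ × (Fin n → ℂ) => φ q.1 ((chartAt (Fin n → ℂ) c).symm q.2)) q := by
  have : IsManifold 𝓘(ℝ, Fin n → ℂ) ∞ X := isManifold_real
  have h2 : ContMDiffAt 𝓘(ℝ, Fin n → ℂ) 𝓘(ℝ, Fin n → ℂ) ∞ (chartAt (Fin n → ℂ) c).symm q.2 :=
    contMDiffOn_chart_symm.contMDiffAt ((chartAt (Fin n → ℂ) c).open_target.mem_nhds hq)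
  have h3 : ContMDiffAt (𝓘(ℝ, ℝ).prod 𝓘(ℝ, Fin n → ℂ)) 𝓘(ℝ, ℝ) ∞
      (fun q : ℝ × (Fin n → ℂ) => φ q.1 ((chartAt (Fin n → ℂ) c).symm q.2)) q :=
    hφ.contMDiffAt.comp q (contMDiffAt_fst.prodMk (h2.comp q contMDiffAt_snd))
  -- The product model on `ℝ × ℂⁿ` is identified with the model of the vector space, so that
  -- smoothness on manifolds becomes ordinary smoothness.
  rw [← modelWithCornersSelf_prod, chartedSpaceSelf_prod] at h3
  exact h3.contDiffAt

theorem contDiffAt_potential_right {φ : ℝ → X → ℝ}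
    (hφ : ContMDiff (𝓘(ℝ, ℝ).prod 𝓘(ℝ, Fin n → ℂ)) 𝓘(ℝ, ℝ) ∞ fun p : ℝ × X => φ p.1 p.2)
    {c : X} {z : Fin n → ℂ} (hz : z ∈ (chartAt (Fin n → ℂ) c).target) (t : ℝ) :
    ContDiffAt ℝ ∞ (fun w => (φ t ((chartAt (Fin n → ℂ) c).symm w) : ℂ)) z :=
  Complex.ofRealCLM.contDiff.contDiffAt.comp z
    (ContDiffAt.comp (f := fun w => (t, w)) z (contDiffAt_potential hφ (q := (t, z)) hz)
      (contDiffAt_const.prodMk contDiffAt_id))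

theorem differentiableAt_potential_left {φ : ℝ → X → ℝ}
    (hφ : ContMDiff (𝓘(ℝ, ℝ).prod 𝓘(ℝ, Fin n → ℂ)) 𝓘(ℝ, ℝ) ∞ fun p : ℝ × X => φ p.1 p.2)
    {c : X} {z : Fin n → ℂ} (hz : z ∈ (chartAt (Fin n → ℂ) c).target) (t : ℝ) :
    DifferentiableAt ℝ (fun s => φ s ((chartAt (Fin n → ℂ) c).symm z)) t :=
  (ContDiffAt.comp (f := fun s => (s, z)) t (contDiffAt_potential hφ (q := (t, z)) hz)
      (contDiffAt_id.prodMk contDiffAt_const)).differentiableAt (by norm_num)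

section

variable (h : HermitianMetric n L) {φ : ℝ → X → ℝ}
    (hφ : ContMDiff (𝓘(ℝ, ℝ).prod 𝓘(ℝ, Fin n → ℂ)) 𝓘(ℝ, ℝ) ∞ fun p : ℝ × X => φ p.1 p.2) (c : X)

include hφ

theorem lineCurvature_eq (j : ℕ) (t : ℝ) {z : Fin n → ℂ}
    (hz : z ∈ (chartAt (Fin n → ℂ) c).target) :
    lineCurvature h (φ t) j c z = (j : ℂ) • formOfMatrix (metricMatrix h (φ t) c z) := by
  have h0 := mem_baseSet_trivializationAt ℂ L ((chartAt (Fin n → ℂ) c).symm z)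
  set x₀ := (chartAt (Fin n → ℂ) c).symm z with hx₀
  have h1 := (contDiffAt_log_weight h hz h0).of_le (m := 2) (by norm_cast)
  have h2 := (contDiffAt_potential_right hφ hz t).of_le (m := 2) (by norm_cast)
  have h3 : (fun w => ((Real.log (powerWeight h (φ t) j x₀
        ((chartAt (Fin n → ℂ) c).symm w)) : ℝ) : ℂ)) =ᶠ[𝓝 z]
      fun w => -(j : ℂ) * (φ t ((chartAt (Fin n → ℂ) c).symm w) : ℂ) +
        (j : ℂ) * (Real.log (h.weight x₀ ((chartAt (Fin n → ℂ) c).symm w)) : ℂ) := by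
    filter_upwards [eventually_symm_mem hz h0] with w hw
    rw [powerWeight, Real.log_mul (Real.exp_pos _).ne' (pow_ne_zero _ (weight_pos h hw).ne'),
      Real.log_exp, Real.log_pow]
    push_cast
    ring
  rw [lineCurvature, hess_congr h3, hess_add (contDiffAt_const.mul h2) (contDiffAt_const.mul h1),
    hess_const_mul _ h2, hess_const_mul _ h1, ← formOfMatrix_neg, ← formOfMatrix_smul, metricMatrix]
  congr 1
  rw [smul_add, smul_neg, neg_add, neg_smul, neg_neg, add_comm]

theorem lineVariation_eq (j : ℕ) (t : ℝ) {z : Fin n → ℂ}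
    (hz : z ∈ (chartAt (Fin n → ℂ) c).target) :
    lineVariation h φ j t ((chartAt (Fin n → ℂ) c).symm z) =
      -(j * deriv (fun s => φ s ((chartAt (Fin n → ℂ) c).symm z)) t) := by
  set x := (chartAt (Fin n → ℂ) c).symm z
  have hd := (differentiableAt_potential_left hφ hz t).hasDerivAt
  have hw := (weight_pos h (mem_baseSet_trivializationAt ℂ L x)).ne'
  have h1 : HasDerivAt (fun s => powerWeight h (φ s) j x x) _ t :=
    ((hd.const_mul (j : ℝ)).neg.exp).mul_const (h.weight x x ^ j)
  rw [lineVariation, h1.deriv, powerWeight]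
  have := Real.exp_pos (-(j * φ t x))
  simp only [Pi.neg_apply]
  change Real.exp (-(j * φ t x)) * _ * _ * _ = _
  field_simp
  rfl

theorem powerCurvature_eq (t : ℝ) {z : Fin n → ℂ}
    (hz : z ∈ (chartAt (Fin n → ℂ) c).target) (b : ℂ) :
    powerCurvature h φ c z t b = fun j : ℕ => (j : ℂ) •
      (formOfMatrix (metricMatrix h (φ t) c z) + algebraMap ℂ (EvenForm n)
        (b * -((deriv (fun s => φ s ((chartAt (Fin n → ℂ) c).symm z)) t : ℝ) : ℂ))) := by
  funext j
  rw [powerCurvature, lineCurvature_eq h hφ c j t hz, lineVariation_eq h hφ c j t hz, smul_add,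
    Algebra.smul_def (j : ℂ) (algebraMap ℂ (EvenForm n) _), ← map_mul]
  congr 2
  rw [Complex.ofReal_neg, Complex.ofReal_mul, Complex.ofReal_natCast]
  ring

/-- All line bundle curvatures are multiples of one form `Ω - b φ'`, so the infinite sum collapses
to its part of degree `n + 1`. -/
theorem transgression_eq (ξ : Polynomial ℚ) (t : ℝ) {z : Fin n → ℂ}
    (hz : z ∈ (chartAt (Fin n → ℂ) c).target) :
    transgression h ξ φ c z t = ∑ q ∈ Finset.range (n + 2),
      ((moment q ξ : ℚ) : ℂ) / (q.factorial : ℂ) *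
        topVariation n (curvature (metricMatrix h (φ t) c) z)
          (degreeZero ((Matrix.of fun i j => deriv (fun s => metricMatrix h (φ s) c z i j) t) *
            (metricMatrix h (φ t) c z)⁻¹))
          (formOfMatrix (metricMatrix h (φ t) c z))
          ((deriv (fun s => φ s ((chartAt (Fin n → ℂ) c).symm z)) t : ℝ) : ℂ) (n + 1 - q) q := by
  rw [← tsum_deriv_topCoeff (map_scaleForm_curvature 2 _ _) (map_scaleForm_degreeZero 2 _)
    (scaleForm_formOfMatrix 2 _) _ fun q => ((moment q ξ : ℚ) : ℂ) / (q.factorial : ℂ)]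
  simp only [transgression, powerCurvature_eq h hφ c t hz, chernCharacter_smul, tangentCurvature,
    one_smul]

end

variable [ContMDiffVectorBundle ω ℂ L 𝓘(ℂ, Fin n → ℂ)]

/-- The definition uses the frame attached to the point `z` itself; a fixed frame is needed to
differentiate in `z`. -/
theorem metricMatrix_eq (h : HermitianMetric n L) (φ : X → ℝ) {c x₀ : X} {z : Fin n → ℂ}
    (hz : z ∈ (chartAt (Fin n → ℂ) c).target)
    (h0 : (chartAt (Fin n → ℂ) c).symm z ∈ (trivializationAt ℂ L x₀).baseSet) :
    metricMatrix h φ c z =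
      -hess (fun w => (Real.log (h.weight x₀ ((chartAt (Fin n → ℂ) c).symm w)) : ℂ)) z +
        hess (fun w => (φ ((chartAt (Fin n → ℂ) c).symm w) : ℂ)) z := by
  rw [metricMatrix, hess_log_weight_eq h hz (mem_baseSet_trivializationAt ℂ L _) h0]

theorem contDiffOn_metricMatrix (h : HermitianMetric n L) {φ : ℝ → X → ℝ}
    (hφ : ContMDiff (𝓘(ℝ, ℝ).prod 𝓘(ℝ, Fin n → ℂ)) 𝓘(ℝ, ℝ) ∞ fun p : ℝ × X => φ p.1 p.2)
    (c : X) (i j : Fin n) :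
    ContDiffOn ℝ ∞ (fun q : ℝ × (Fin n → ℂ) => metricMatrix h (φ q.1) c q.2 i j)
      (Set.univ ×ˢ (chartAt (Fin n → ℂ) c).target) := by
  intro q hq
  set x₀ := (chartAt (Fin n → ℂ) c).symm q.2
  set V := (chartAt (Fin n → ℂ) c).target ∩
    (chartAt (Fin n → ℂ) c).symm ⁻¹' (trivializationAt ℂ L x₀).baseSet
  have hV : IsOpen ((Set.univ : Set ℝ) ×ˢ V) := isOpen_univ.prod
    ((chartAt (Fin n → ℂ) c).isOpen_inter_preimage_symm (trivializationAt ℂ L x₀).open_baseSet)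
  have h1 : ContDiffOn ℝ ∞ (fun q : ℝ × (Fin n → ℂ) =>
      (Real.log (h.weight x₀ ((chartAt (Fin n → ℂ) c).symm q.2)) : ℂ))
      ((Set.univ : Set ℝ) ×ˢ V) := fun p hp =>
    (ContDiffAt.comp p (contDiffAt_log_weight h hp.2.1 hp.2.2) contDiffAt_snd).contDiffWithinAt
  have h2 : ContDiffOn ℝ ∞ (fun q : ℝ × (Fin n → ℂ) =>
      (φ q.1 ((chartAt (Fin n → ℂ) c).symm q.2) : ℂ)) ((Set.univ : Set ℝ) ×ˢ V) := fun p hp =>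
    (Complex.ofRealCLM.contDiff.contDiffAt.comp p
      (contDiffAt_potential hφ hp.2.1)).contDiffWithinAt
  have h3 := (contDiffOn_hess hV h1 i j).neg.add (contDiffOn_hess hV h2 i j)
  refine ContDiffAt.contDiffWithinAt ((h3.congr fun p hp => ?_).contDiffAt
    (hV.mem_nhds ⟨trivial, hq.2, mem_baseSet_trivializationAt ℂ L _⟩))
  rw [metricMatrix_eq h _ hp.2.1 hp.2.2]
  rfl

/-- The points `(t, z)` at which the metric `g_t` is nondegenerate. -/
def nondegenerateSet (h : HermitianMetric n L) (φ : ℝ → X → ℝ) (c : X) :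
    Set (ℝ × (Fin n → ℂ)) :=
  (Set.univ ×ˢ (chartAt (Fin n → ℂ) c).target) ∩
    (fun q => (metricMatrix h (φ q.1) c q.2).det) ⁻¹' {0}ᶜ

variable (h : HermitianMetric n L) {φ : ℝ → X → ℝ}
    (hφ : ContMDiff (𝓘(ℝ, ℝ).prod 𝓘(ℝ, Fin n → ℂ)) 𝓘(ℝ, ℝ) ∞ fun p : ℝ × X => φ p.1 p.2) (c : X)

include hφ

/-- Positivity is known only for `t ∈ [0,1]`, but derivatives call for an open set; nondegeneracy
provides one containing `[0,1]` times the chart. -/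
theorem isOpen_nondegenerateSet : IsOpen (nondegenerateSet h φ c) :=
  (contDiffOn_det (contDiffOn_metricMatrix h hφ c)).continuousOn.isOpen_inter_preimage
    (isOpen_univ.prod (chartAt (Fin n → ℂ) c).open_target) isOpen_compl_singleton

theorem contDiffOn_metricMatrix_inv (i j : Fin n) :
    ContDiffOn ℝ ∞ (fun q : ℝ × (Fin n → ℂ) => (metricMatrix h (φ q.1) c q.2)⁻¹ i j)
      (nondegenerateSet h φ c) :=
  contDiffOn_inv_apply (fun i j => (contDiffOn_metricMatrix h hφ c i j).mono
    Set.inter_subset_left) (fun _ hq => hq.2) i j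

theorem contDiffOn_connectionCoeff (k i j : Fin n) :
    ContDiffOn ℝ ∞ (fun q : ℝ × (Fin n → ℂ) =>
      connectionCoeff (metricMatrix h (φ q.1) c) k q.2 i j) (nondegenerateSet h φ c) := by
  refine contDiffOn_mul_apply (fun i j => ?_) (contDiffOn_metricMatrix_inv h hφ c) i j
  exact contDiffOn_wirt (isOpen_nondegenerateSet h hφ c) ((contDiffOn_metricMatrix h hφ c i j).mono
    Set.inter_subset_left) k

theorem contDiffOn_curvatureCoeff (k l i j : Fin n) :
    ContDiffOn ℝ ∞ (fun q : ℝ × (Fin n → ℂ) =>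
      wirtBar l (fun w => connectionCoeff (metricMatrix h (φ q.1) c) k w i j) q.2)
      (nondegenerateSet h φ c) :=
  contDiffOn_wirtBar (isOpen_nondegenerateSet h hφ c) (contDiffOn_connectionCoeff h hφ c k i j) l

theorem contDiffOn_metricVariation (i j : Fin n) :
    ContDiffOn ℝ ∞ (fun q : ℝ × (Fin n → ℂ) =>
      ((Matrix.of fun i j => deriv (fun s => metricMatrix h (φ s) c q.2 i j) q.1) *
        (metricMatrix h (φ q.1) c q.2)⁻¹) i j) (nondegenerateSet h φ c) := by
  refine contDiffOn_mul_apply (fun i j => ?_) (contDiffOn_metricMatrix_inv h hφ c) i j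
  exact contDiffOn_deriv_fst (isOpen_nondegenerateSet h hφ c)
    ((contDiffOn_metricMatrix h hφ c i j).mono Set.inter_subset_left)

theorem contDiffOn_deriv_potential :
    ContDiffOn ℝ ∞ (fun q : ℝ × (Fin n → ℂ) =>
      ((deriv (fun s => φ s ((chartAt (Fin n → ℂ) c).symm q.2)) q.1 : ℝ) : ℂ))
      (Set.univ ×ˢ (chartAt (Fin n → ℂ) c).target) := by
  have hU : IsOpen ((Set.univ : Set ℝ) ×ˢ (chartAt (Fin n → ℂ) c).target) :=
    isOpen_univ.prod (chartAt (Fin n → ℂ) c).open_target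
  have h2 : ContDiffOn ℝ ∞ (fun q : ℝ × (Fin n → ℂ) =>
      (φ q.1 ((chartAt (Fin n → ℂ) c).symm q.2) : ℂ))
      ((Set.univ : Set ℝ) ×ˢ (chartAt (Fin n → ℂ) c).target) := fun p hp =>
    (Complex.ofRealCLM.contDiff.contDiffAt.comp p
      (contDiffAt_potential hφ hp.2)).contDiffWithinAt
  refine (contDiffOn_deriv_fst hU h2).congr fun q hq => ?_
  exact ((differentiableAt_potential_left hφ hq.2 q.1).hasDerivAt.ofReal_comp).deriv.symm

end Metric

/-! ## Continuous families of forms -/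

section Families

open scoped TensorProduct

variable {P : Type*} [TopologicalSpace P] {A : Type*} [CommRing A] [Algebra ℂ A]
  {ι : Type*} [Fintype ι] [DecidableEq ι]

variable (A) in
/-- The value at `p` of an element of `C(P, ℂ) ⊗ A`. -/
def evalFamily (p : P) : C(P, ℂ) ⊗[ℂ] A →ₐ[ℂ] A :=
  Algebra.TensorProduct.productMap
    ((Algebra.ofId ℂ A).comp (ContinuousMap.evalAlgHom ℂ ℂ p)) (AlgHom.id ℂ A)

theorem evalFamily_tmul (p : P) (f : C(P, ℂ)) (x : A) :
    evalFamily A p (f ⊗ₜ x) = f p • x := by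
  rw [evalFamily, Algebra.TensorProduct.productMap_apply_tmul, Algebra.smul_def]
  rfl

/-- A family of elements of `A` with continuous coefficients. -/
def ContinuousFamily (F : P → A) : Prop :=
  ∃ b : C(P, ℂ) ⊗[ℂ] A, ∀ p, evalFamily A p b = F p

namespace ContinuousFamily

variable {F F' : P → A}

/-- Only linear functionals of a family need be continuous, which avoids a topology on `A`; on a
pure tensor the claim is immediate. -/
theorem continuous_linear (hF : ContinuousFamily F) (ℓ : A →ₗ[ℂ] ℂ) :
    Continuous fun p => ℓ (F p) := by
  obtain ⟨b, hb⟩ := hF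
  simp only [← hb]
  clear hb
  induction b using TensorProduct.induction_on with
  | zero => simpa using continuous_const
  | tmul f x =>
    simp only [evalFamily_tmul, map_smul, smul_eq_mul]
    exact f.continuous.mul continuous_const
  | add x y hx hy =>
    simp only [map_add]
    exact hx.add hy

theorem mul (hF : ContinuousFamily F) (hF' : ContinuousFamily F') :
    ContinuousFamily fun p => F p * F' p := by
  obtain ⟨b, hb⟩ := hF
  obtain ⟨b', hb'⟩ := hF'
  exact ⟨b * b', fun p => by rw [map_mul, hb, hb']⟩

theorem neg (hF : ContinuousFamily F) : ContinuousFamily fun p => -F p := by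
  obtain ⟨b, hb⟩ := hF
  exact ⟨-b, fun p => (map_neg (evalFamily A p) b).trans (by rw [hb])⟩

theorem const_smul (hF : ContinuousFamily F) (s : ℂ) : ContinuousFamily fun p => s • F p := by
  obtain ⟨b, hb⟩ := hF
  exact ⟨s • b, fun p => by rw [map_smul, hb]⟩

theorem smul_const {f : P → ℂ} (hf : Continuous f) (a : A) :
    ContinuousFamily fun p => f p • a :=
  ⟨(⟨f, hf⟩ : C(P, ℂ)) ⊗ₜ a, fun p => evalFamily_tmul p _ a⟩

theorem algebraMap_comp {f : P → ℂ} (hf : Continuous f) :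
    ContinuousFamily fun p => algebraMap ℂ A (f p) := by
  simpa only [Algebra.algebraMap_eq_smul_one] using smul_const hf 1

theorem pow (hF : ContinuousFamily F) (k : ℕ) : ContinuousFamily fun p => F p ^ k := by
  induction k with
  | zero => simpa using algebraMap_comp (P := P) (A := A) (continuous_const (y := (1 : ℂ)))
  | succ k ih => simpa only [pow_succ] using ih.mul hF

theorem sum {κ : Type*} {s : Finset κ} {F : κ → P → A}
    (hF : ∀ i ∈ s, ContinuousFamily (F i)) : ContinuousFamily fun p => ∑ i ∈ s, F i p := by
  choose! b hb using hF
  exact ⟨∑ i ∈ s, b i, fun p => by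
    rw [map_sum]; exact Finset.sum_congr rfl fun i hi => hb i hi p⟩

/-- The Todd polynomial is computed inside `C(P, ℂ) ⊗ A`, and evaluation at a point commutes with it
by naturality. -/
theorem todd {R : P → Matrix ι ι A} (hR : ∀ i j, ContinuousFamily fun p => R p i j) (k : ℕ) :
    ContinuousFamily fun p => todd k (R p) := by
  choose R' hR' using hR
  refine ⟨HigherEnergy.todd k (Matrix.of R'), fun p => ?_⟩
  refine (map_todd (evalFamily A p) k (Matrix.of R')).trans (congrArg _ ?_)
  ext1 i j
  exact hR' i j p

theorem toddDeriv {R G : P → Matrix ι ι A} (hR : ∀ i j, ContinuousFamily fun p => R p i j)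
    (hG : ∀ i j, ContinuousFamily fun p => G p i j) (k : ℕ) :
    ContinuousFamily fun p => toddDeriv k (R p) (G p) := by
  choose R' hR' using hR
  choose G' hG' using hG
  refine ⟨HigherEnergy.toddDeriv k (Matrix.of R') (Matrix.of G'), fun p => ?_⟩
  refine (map_toddDeriv (evalFamily A p) k (Matrix.of R') (Matrix.of G')).trans
    (congrArg₂ _ ?_ ?_)
  · ext1 i j
    exact hR' i j p
  · ext1 i j
    exact hG' i j p

theorem formOfMatrix {n : ℕ} {a : P → Matrix (Fin n) (Fin n) ℂ}
    (ha : ∀ i j, Continuous fun p => a p i j) :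
    ContinuousFamily fun p => formOfMatrix (a p) :=
  sum fun k _ => sum fun l _ => smul_const (ha k l) _

end ContinuousFamily

end Families

/-! ## Integrals over compact manifolds -/

section Integral

theorem continuousOn_intervalIntegral {E : Type*} [TopologicalSpace E] [FirstCountableTopology E]
    {U : Set E} {F : ℝ → E → ℂ}
    (hF : Continuous fun p : Set.Icc (0 : ℝ) 1 × U => F p.1 p.2) :
    ContinuousOn (fun z => ∫ t in (0 : ℝ)..1, F t z) U := by
  rw [continuousOn_iff_continuous_domRestrict]
  -- Projecting `t` to `[0,1]` extends the integrand continuously to all of `ℝ` without changing the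
  -- integral.
  have h1 : Continuous fun z : U => ∫ t in (0 : ℝ)..1,
      F (Set.projIcc (0 : ℝ) 1 zero_le_one t) z :=
    intervalIntegral.continuous_parametric_intervalIntegral_of_continuous'
      (f := fun (z : U) t => F (Set.projIcc (0 : ℝ) 1 zero_le_one t) z)
      (hF.comp (g := fun p : Set.Icc (0 : ℝ) 1 × U => F p.1 p.2)
        (f := fun q : U × ℝ => (Set.projIcc (0 : ℝ) 1 zero_le_one q.2, q.1))
        ((continuous_projIcc.comp continuous_snd).prodMk continuous_fst)) 0 1
  convert h1 using 2 with z
  refine intervalIntegral.integral_congr fun t ht => ?_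
  rw [Set.uIcc_of_le zero_le_one] at ht
  simp only [Set.projIcc_of_mem zero_le_one ht]

theorem intervalIntegrable_of_continuous {E : Type*} [TopologicalSpace E] {U : Set E}
    {F : ℝ → E → ℂ} (hF : Continuous fun p : Set.Icc (0 : ℝ) 1 × U => F p.1 p.2) {z : E}
    (hz : z ∈ U) : IntervalIntegrable (fun t => F t z) MeasureTheory.volume 0 1 := by
  refine ContinuousOn.intervalIntegrable ?_
  rw [Set.uIcc_of_le zero_le_one, continuousOn_iff_continuous_domRestrict]
  exact hF.comp (continuous_id.prodMk (continuous_const (y := (⟨z, hz⟩ : U))))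

variable {n : ℕ} {X : Type*} [TopologicalSpace X] [CompactSpace X] [T2Space X]
  [ChartedSpace (Fin n → ℂ) X]

theorem integral_congr {f g : X → (Fin n → ℂ) → ℂ}
    (h : ∀ c, ∀ z ∈ (chartAt (Fin n → ℂ) c).target, f c z = g c z) :
    integral f = integral g := by
  refine finsum_congr fun c => ?_
  refine MeasureTheory.setIntegral_congr_fun (chartAt (Fin n → ℂ) c).open_target.measurableSet
    fun z hz => ?_
  simp only [h c z hz]

theorem const_mul_integral (a : ℂ) (f : X → (Fin n → ℂ) → ℂ) :
    a * integral f = integral fun c z => a * f c z := by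
  rw [integral, integral, ← smul_eq_mul, smul_finsum]
  refine finsum_congr fun c => ?_
  rw [smul_eq_mul, ← MeasureTheory.integral_const_mul]
  simp only [mul_left_comm]

/-- Although `f` may be unbounded near the boundary of the chart, the cutoff vanishes off the
compact image of its support, where the product is continuous. -/
theorem integrableOn_chartPartition_mul {f : (Fin n → ℂ) → ℂ} (c : X)
    (hf : ContinuousOn f (chartAt (Fin n → ℂ) c).target) :
    MeasureTheory.IntegrableOn
      (fun z => (chartPartition n X c ((chartAt (Fin n → ℂ) c).symm z) : ℂ) * f z)
      (chartAt (Fin n → ℂ) c).target := by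
  set e := chartAt (Fin n → ℂ) c
  have hsub : tsupport (chartPartition n X c) ⊆ e.source := (exists_chartPartition n X).choose_spec c
  have hK : IsCompact (e '' tsupport (chartPartition n X c)) :=
    (isClosed_tsupport _).isCompact.image_of_continuousOn (e.continuousOn.mono hsub)
  have hKU : e '' tsupport (chartPartition n X c) ⊆ e.target := by
    rintro _ ⟨x, hx, rfl⟩
    exact e.map_source (hsub hx)
  have hcont : ContinuousOn (fun z => (chartPartition n X c (e.symm z) : ℂ) * f z) e.target :=
    (Complex.continuous_ofReal.comp_continuousOn
      ((chartPartition n X c).continuous.comp_continuousOn e.continuousOn_symm)).mul hf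
  refine ((hcont.mono hKU).integrableOn_compact hK).of_forall_sdiff_eq_zero
    e.open_target.measurableSet fun z hz => ?_
  have h0 : chartPartition n X c (e.symm z) = 0 := by
    by_contra h0
    exact hz.2 ⟨e.symm z, subset_tsupport _ h0, e.right_inv hz.1⟩
  rw [h0, Complex.ofReal_zero, zero_mul]

theorem integral_sub {f g : X → (Fin n → ℂ) → ℂ}
    (hf : ∀ c, ContinuousOn (f c) (chartAt (Fin n → ℂ) c).target)
    (hg : ∀ c, ContinuousOn (g c) (chartAt (Fin n → ℂ) c).target) :
    integral (fun c z => f c z - g c z) = integral f - integral g := by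
  -- Compactness and local finiteness leave finitely many nonzero members of the partition, so the
  -- `finsum` is additive.
  have hfin : {c : X | chartPartition n X c ≠ 0}.Finite := by
    refine ((chartPartition n X).locallyFinite.finite_nonempty_of_compact).subset fun c hc => ?_
    exact Function.support_nonempty_iff.2 fun h => hc (DFunLike.coe_injective h)
  have hsupp : ∀ k : X → (Fin n → ℂ) → ℂ, (Function.support fun c =>
      ∫ z in (chartAt (Fin n → ℂ) c).target,
        (chartPartition n X c ((chartAt (Fin n → ℂ) c).symm z) : ℂ) * k c z).Finite := by
    refine fun k => hfin.subset fun c hc h => hc ?_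
    simp [h]
  rw [integral, integral, integral, ← finsum_sub_distrib (hsupp f) (hsupp g)]
  refine finsum_congr fun c => ?_
  rw [← MeasureTheory.integral_sub (integrableOn_chartPartition_mul c (hf c))
    (integrableOn_chartPartition_mul c (hg c))]
  simp only [mul_sub]

end Integral

/-! ## The higher energy -/

section Energy

variable {n : ℕ} {X : Type*} [TopologicalSpace X] [ChartedSpace (Fin n → ℂ) X]
  {L : X → Type*} [∀ x, AddCommGroup (L x)] [∀ x, Module ℂ (L x)]
  [TopologicalSpace (Bundle.TotalSpace ℂ L)] [∀ x, TopologicalSpace (L x)]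
  [FiberBundle ℂ L] [VectorBundle ℂ ℂ L]

/-- The integrand of the first term of the higher energy. -/
def toddIntegrand (h : HermitianMetric n L) (χ : Polynomial ℚ) (l : ℕ) (φ : ℝ → X → ℝ) (c : X)
    (t : ℝ) (z : Fin n → ℂ) : ℂ :=
  ∑ k ∈ Finset.Icc (n + 1 - l) n, ((cCoeff χ l k : ℚ) : ℂ) / (k.factorial : ℂ) *
    topCoeff n (toddDeriv (n + 1 - k)
      ((Complex.I / (2 * Real.pi) : ℂ) • curvature (metricMatrix h (φ t) c) z)
      (degreeZero ((Matrix.of fun i j => deriv (fun s => metricMatrix h (φ s) c z i j) t) *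
        (metricMatrix h (φ t) c z)⁻¹)) * kahlerForm h (φ t) c z ^ k)

/-- The integrand of the second term of the higher energy. -/
def potentialIntegrand (h : HermitianMetric n L) (χ : Polynomial ℚ) (l : ℕ) (φ : ℝ → X → ℝ)
    (c : X) (t : ℝ) (z : Fin n → ℂ) : ℂ :=
  ∑ k ∈ Finset.Icc (n + 1 - l) (n + 1), (k : ℂ) * ((cCoeff χ l k : ℚ) : ℂ) / (k.factorial : ℂ) *
    topCoeff n (todd (n + 1 - k)
      ((Complex.I / (2 * Real.pi) : ℂ) • curvature (metricMatrix h (φ t) c) z) *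
      algebraMap ℂ (EvenForm n)
        ((deriv (fun s => φ s ((chartAt (Fin n → ℂ) c).symm z)) t : ℝ) : ℂ) *
      kahlerForm h (φ t) c z ^ (k - 1))

omit [VectorBundle ℂ ℂ L] in
theorem sum_deriv_eq_toddIntegrand (h : HermitianMetric n L) (χ : Polynomial ℚ) (l : ℕ)
    (φ : ℝ → X → ℝ) (c : X) (t : ℝ) (z : Fin n → ℂ) :
    ∑ k ∈ Finset.Icc (n + 1 - l) n, ((cCoeff χ l k : ℚ) : ℂ) / (k.factorial : ℂ) *
      deriv (fun b : ℝ => topCoeff n (todd (n + 1 - k)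
        (tangentCurvature h φ c z t (Complex.I / (2 * Real.pi)) (b : ℂ)) *
          kahlerForm h (φ t) c z ^ k)) 0 = toddIntegrand h χ l φ c t z :=
  Finset.sum_congr rfl fun k _ => by
    simp only [tangentCurvature]
    rw [(hasDerivAt_topCoeff_todd_mul _ _ _ _).deriv]

variable [IsManifold 𝓘(ℂ, Fin n → ℂ) ω X]

/-- This is the pointwise form of the theorem: moments become `c_{l,k}`, and `(√-1/2π)^n` is
absorbed into `R` and `Ω`. -/
theorem pow_mul_transgression (h : HermitianMetric n L) {φ : ℝ → X → ℝ}
    (hφ : ContMDiff (𝓘(ℝ, ℝ).prod 𝓘(ℝ, Fin n → ℂ)) 𝓘(ℝ, ℝ) ∞ fun p : ℝ × X => φ p.1 p.2)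
    (χ : Polynomial ℚ) {l : ℕ} (hl : l ≤ n + 1) (m : ℕ) (c : X) (t : ℝ) {z : Fin n → ℂ}
    (hz : z ∈ (chartAt (Fin n → ℂ) c).target) :
    (Complex.I / (2 * Real.pi)) ^ n * transgression h (virtualBundle χ n l m) φ c z t =
      toddIntegrand h χ l φ c t z - potentialIntegrand h χ l φ c t z := by
  have hsub : Finset.Icc (n + 1 - l) (n + 1) ⊆ Finset.range (n + 2) := fun k hk => by
    rw [Finset.mem_Icc] at hk
    rw [Finset.mem_range]
    omega
  have hins : Finset.Icc (n + 1 - l) (n + 1) = insert (n + 1) (Finset.Icc (n + 1 - l) n) := by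
    ext k
    simp only [Finset.mem_insert, Finset.mem_Icc]
    omega
  -- The term `k = n + 1`, which vanishes because `Td_0` is constant, is added so that both sums
  -- have the same range.
  have htodd : toddIntegrand h χ l φ c t z = ∑ k ∈ Finset.Icc (n + 1 - l) (n + 1),
      ((cCoeff χ l k : ℚ) : ℂ) / (k.factorial : ℂ) * topCoeff n (toddDeriv (n + 1 - k)
        ((Complex.I / (2 * Real.pi) : ℂ) • curvature (metricMatrix h (φ t) c) z)
        (degreeZero ((Matrix.of fun i j => deriv (fun s => metricMatrix h (φ s) c z i j) t) *
          (metricMatrix h (φ t) c z)⁻¹)) * kahlerForm h (φ t) c z ^ k) := by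
    rw [hins, Finset.sum_insert (by simp), Nat.sub_self, toddDeriv_zero, zero_mul, map_zero,
      mul_zero, zero_add, toddIntegrand]
  -- The indices below `n + 1 - l` are discarded because the corresponding moments vanish.
  rw [transgression_eq h hφ c _ t hz, ← Finset.sum_subset hsub, htodd, potentialIntegrand,
    ← Finset.sum_sub_distrib, Finset.mul_sum]
  · refine Finset.sum_congr rfl fun k hk => ?_
    rw [Finset.mem_Icc] at hk
    rw [moment_virtualBundle_of_le χ hl m hk.1 hk.2, mul_left_comm, pow_mul_topVariation _
      (map_scaleForm_curvature _ _ _) (map_scaleForm_degreeZero _ _) (scaleForm_formOfMatrix _ _),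
      topVariation, ← kahlerForm]
    ring
  · intro k hk hk'
    rw [Finset.mem_range] at hk
    rw [Finset.mem_Icc] at hk'
    rw [moment_virtualBundle_of_lt χ m (by omega : k < n + 1 - l)]
    simp

variable [ContMDiffVectorBundle ω ℂ L 𝓘(ℂ, Fin n → ℂ)]

section Continuity

variable {h : HermitianMetric n L} {φ : X → ℝ} (p : KahlerPath h φ) (c : X)

omit [VectorBundle ℂ ℂ L] [IsManifold 𝓘(ℂ, Fin n → ℂ) ω X]
  [ContMDiffVectorBundle ω ℂ L 𝓘(ℂ, Fin n → ℂ)] in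
theorem mem_nondegenerateSet (q : Set.Icc (0 : ℝ) 1 × (chartAt (Fin n → ℂ) c).target) :
    ((q.1 : ℝ), (q.2 : Fin n → ℂ)) ∈ nondegenerateSet h p.pot c :=
  ⟨⟨trivial, q.2.2⟩, ((p.mem q.1 q.1.2).2 c q.2 q.2.2).det_pos.ne'⟩

omit [VectorBundle ℂ ℂ L] [IsManifold 𝓘(ℂ, Fin n → ℂ) ω X]
  [ContMDiffVectorBundle ω ℂ L 𝓘(ℂ, Fin n → ℂ)] in
theorem continuous_of_contDiffOn_nondegenerateSet {F : ℝ × (Fin n → ℂ) → ℂ}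
    (hF : ContDiffOn ℝ ∞ F (nondegenerateSet h p.pot c)) :
    Continuous fun q : Set.Icc (0 : ℝ) 1 × (chartAt (Fin n → ℂ) c).target =>
      F ((q.1 : ℝ), (q.2 : Fin n → ℂ)) :=
  hF.continuousOn.comp_continuous
    ((continuous_subtype_val.comp continuous_fst).prodMk
      (continuous_subtype_val.comp continuous_snd)) (mem_nondegenerateSet p c)

theorem continuousFamily_curvature (s : ℂ) (i j : Fin n) :
    ContinuousFamily fun q : Set.Icc (0 : ℝ) 1 × (chartAt (Fin n → ℂ) c).target =>
      (s • curvature (metricMatrix h (p.pot q.1) c) q.2) i j :=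
  (ContinuousFamily.formOfMatrix fun k l => continuous_of_contDiffOn_nondegenerateSet p c
    (contDiffOn_curvatureCoeff h p.smooth c k l i j)).neg.const_smul s

theorem continuousFamily_kahlerForm :
    ContinuousFamily fun q : Set.Icc (0 : ℝ) 1 × (chartAt (Fin n → ℂ) c).target =>
      kahlerForm h (p.pot q.1) c q.2 :=
  (ContinuousFamily.formOfMatrix fun i j => continuous_of_contDiffOn_nondegenerateSet p c
    ((contDiffOn_metricMatrix h p.smooth c i j).mono Set.inter_subset_left)).const_smul _

theorem continuousFamily_metricVariation (i j : Fin n) :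
    ContinuousFamily fun q : Set.Icc (0 : ℝ) 1 × (chartAt (Fin n → ℂ) c).target =>
      degreeZero ((Matrix.of fun i j => deriv (fun s => metricMatrix h (p.pot s) c q.2 i j) q.1) *
        (metricMatrix h (p.pot q.1) c q.2)⁻¹) i j :=
  ContinuousFamily.algebraMap_comp (continuous_of_contDiffOn_nondegenerateSet p c
    (contDiffOn_metricVariation h p.smooth c i j))

theorem continuous_toddIntegrand (χ : Polynomial ℚ) (l : ℕ) :
    Continuous fun q : Set.Icc (0 : ℝ) 1 × (chartAt (Fin n → ℂ) c).target =>
      toddIntegrand h χ l p.pot c q.1 q.2 :=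
  continuous_finsetSum _ fun k _ => continuous_const.mul
    (((ContinuousFamily.toddDeriv (continuousFamily_curvature p c _)
      (continuousFamily_metricVariation p c) _).mul
        ((continuousFamily_kahlerForm p c).pow k)).continuous_linear (topCoeff n))

theorem continuous_potentialIntegrand (χ : Polynomial ℚ) (l : ℕ) :
    Continuous fun q : Set.Icc (0 : ℝ) 1 × (chartAt (Fin n → ℂ) c).target =>
      potentialIntegrand h χ l p.pot c q.1 q.2 :=
  continuous_finsetSum _ fun k _ => continuous_const.mul
    ((((ContinuousFamily.todd (continuousFamily_curvature p c _) _).mul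
      (ContinuousFamily.algebraMap_comp (continuous_of_contDiffOn_nondegenerateSet p c
        ((contDiffOn_deriv_potential p.smooth c).mono Set.inter_subset_left)))).mul
        ((continuousFamily_kahlerForm p c).pow (k - 1))).continuous_linear (topCoeff n))

end Continuity

theorem higherEnergy_eq [CompactSpace X] [T2Space X] (h : HermitianMetric n L) (χ : Polynomial ℚ)
    {l : ℕ} (hl : l ≤ n + 1) (m : ℕ) {φ : X → ℝ} (p : KahlerPath h φ) :
    higherEnergy h χ l m p =
      integral (fun (c : X) z => ∫ t in (0 : ℝ)..1, toddIntegrand h χ l p.pot c t z) -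
        integral (fun (c : X) z => ∫ t in (0 : ℝ)..1, potentialIntegrand h χ l p.pot c t z) := by
  rw [higherEnergy, tau, const_mul_integral, ← integral_sub
    (fun c => continuousOn_intervalIntegral (continuous_toddIntegrand p c χ l))
    (fun c => continuousOn_intervalIntegral (continuous_potentialIntegrand p c χ l))]
  refine integral_congr fun c z hz => ?_
  rw [← intervalIntegral.integral_sub
    (intervalIntegrable_of_continuous (continuous_toddIntegrand p c χ l) hz)
    (intervalIntegrable_of_continuous (continuous_potentialIntegrand p c χ l) hz),
    ← intervalIntegral.integral_const_mul]
  exact intervalIntegral.integral_congr fun t _ => pow_mul_transgression h p.smooth χ hl m c t hz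

end Energy

end HigherEnergy
end

/-! ### The formula for the higher energy. -/

open HigherEnergy
theorem proposition3 {n : ℕ} {X : Type*} [TopologicalSpace X] [CompactSpace X] [T2Space X]
    [ChartedSpace (Fin n → ℂ) X] [IsManifold 𝓘(ℂ, Fin n → ℂ) ω X]
    (L : X → Type*) [∀ x, AddCommGroup (L x)] [∀ x, Module ℂ (L x)]
    [TopologicalSpace (Bundle.TotalSpace ℂ L)] [∀ x, TopologicalSpace (L x)]
    [FiberBundle ℂ L] [VectorBundle ℂ ℂ L] [ContMDiffVectorBundle ω ℂ L 𝓘(ℂ, Fin n → ℂ)]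
    (h : HermitianMetric n L)
    (χ : Polynomial ℚ) (hχ : IsHilbertPolynomial n L χ)
    (l : ℕ) (hl : l ≤ n + 1) (m : ℕ)
    (φ : X → ℝ) (p : KahlerPath h φ) :
    higherEnergy h χ l m p =
      HigherEnergy.integral (fun (c : X) z => ∫ t in (0 : ℝ)..1,
        ∑ k ∈ Finset.Icc (n + 1 - l) n, ((cCoeff χ l k : ℚ) : ℂ) / (k.factorial : ℂ) *
          deriv (fun b : ℝ => topCoeff n
            (todd (n + 1 - k)
                (tangentCurvature h p.pot c z t (Complex.I / (2 * Real.pi)) (b : ℂ)) *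
              kahlerForm h (p.pot t) c z ^ k)) 0)
      - HigherEnergy.integral (fun (c : X) z => ∫ t in (0 : ℝ)..1,
        ∑ k ∈ Finset.Icc (n + 1 - l) (n + 1),
          (k : ℂ) * ((cCoeff χ l k : ℚ) : ℂ) / (k.factorial : ℂ) *
            topCoeff n
              (todd (n + 1 - k)
                  ((Complex.I / (2 * Real.pi) : ℂ) • curvature (metricMatrix h (p.pot t) c) z) *
                algebraMap ℂ (EvenForm n)
                  ((deriv (fun s => p.pot s ((chartAt (Fin n → ℂ) c).symm z)) t : ℝ) : ℂ) *
                kahlerForm h (p.pot t) c z ^ (k - 1))) := by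
  rw [higherEnergy_eq h χ hl m p]
  simp only [sum_deriv_eq_toddIntegrand]
  rfl
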